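/- Let $f$ be an orientation-preserving $C^2$ diffeomorphism of $[0,1]$ with no fixed point in $(0,1)$. Let $\mathrm{Diff}^{1+\mathrm{bv}}_+([0,1])$ be the group of orientation-preserving $C^1$ diffeomorphisms $h$ of $[0,1]$ whose derivative $Dh$ has finite total variation, with the topology given by the distance $\|g-h\|_\infty+\|Dg-Dh\|_\infty+\mathrm{var}(Dg-Dh)$, and let the conjugacy class of $f$ be the set of all $hfh^{-1}$ with $h\in \mathrm{Diff}^{1+\mathrm{bv}}_+([0,1])$. Let $X$ be the generating (Szekeres) vector field of $f$ on $[0,1)$, that is, the unique vector field that is $C^1$ on $[0,1)$, extends continuously to $[0,1]$, and has a flow $(f_t)_{t\in\mathbb R}$ on $[0,1)$ with $f_1=f$; similarly let $Y$ be the generating vector field of $f$ on $(0,1]$, with flow $(f^t)_{t\in\mathbb R}$. For $a,b\in(0,1)$ put $\psi_X(t)=f_t(a)$, $\psi_Y(t)=f^t(b)$ and $M_f^{a,b}=\psi_Y^{-1}\circ\psi_X:\mathbb R\to\mathbb R$, which commutes with the translation by $1$ and so induces a diffeomorphism of the circle $\mathbb R/\mathbb Z$. The Mather invariant $M_f$ of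 $f$ is the class of this circle diffeomorphism modulo pre- and post-composition with rotations (it does not depend on $a,b$); it is trivial if it is the class of rotations. Then the identity of $[0,1]$ lies in the closure of the conjugacy class of $f$ in $\mathrm{Diff}^{1+\mathrm{bv}}_+([0,1])$ if and only if both endpoints are parabolic fixed points of $f$, i.e. $Df(0)=Df(1)=1$, and the Mather invariant of $f$ is trivial. -/

import Mathlib

namespace IntervalDiffeo

/-- Orientation-preserving homeomorphisms of `[0,1]`: the increasing bijections of `[0,1]`.
They form a group under composition, `(g * h) x = g (h x)`. -/
abbrev Homeo : Type := Set.Icc (0 : ℝ) 1 ≃o Set.Icc (0 : ℝ) 1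

/-- A homeomorphism of `[0,1]` viewed as a real function; only its values on `[0,1]` matter
(it is extended by constants outside of `[0,1]`). -/
noncomputable def toFun (f : Homeo) : ℝ → ℝ :=
  Set.IccExtend (zero_le_one : (0 : ℝ) ≤ 1) (fun x => (f x : ℝ))

/-- The derivative `Df` on `[0,1]` (one-sided at the endpoints). -/
noncomputable def D (f : Homeo) (x : ℝ) : ℝ :=
  derivWithin (toFun f) (Set.Icc (0 : ℝ) 1) x

/-- `f ∈ Diff₊ʳ([0,1])`: both `f` and its inverse are of class `Cʳ` on `[0,1]`. -/
def IsDiffeo (r : ℕ) (f : Homeo) : Prop :=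
  ContDiffOn ℝ r (toFun f) (Set.Icc 0 1) ∧ ContDiffOn ℝ r (toFun f⁻¹) (Set.Icc 0 1)

/-- `f ∈ Diff₊^{1+bv}([0,1])`: a `C¹` diffeomorphism whose derivative has finite total
variation. -/
def IsDiffeoBV (f : Homeo) : Prop :=
  IsDiffeo 1 f ∧ BoundedVariationOn (D f) (Set.Icc 0 1)

/-- `f` has no fixed point in the open interval `(0,1)`. -/
def NoInteriorFixedPoint (f : Homeo) : Prop :=
  ∀ x : Set.Icc (0 : ℝ) 1, 0 < (x : ℝ) → (x : ℝ) < 1 → f x ≠ x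

/-- The `C^{1+bv}` distance `‖f - g‖_∞ + ‖Df - Dg‖_∞ + var(Df - Dg)`. -/
noncomputable def distBV (f g : Homeo) : ENNReal :=
  (⨆ x ∈ Set.Icc (0 : ℝ) 1, edist (toFun f x) (toFun g x))
    + (⨆ x ∈ Set.Icc (0 : ℝ) 1, edist (D f x) (D g x))
    + eVariationOn (fun x => D f x - D g x) (Set.Icc 0 1)

/-- The conjugacy class of `f`, under conjugation by elements of `Diff₊^{1+bv}([0,1])`. -/
def conjClassBV (f : Homeo) : Set Homeo :=
  {g | ∃ h : Homeo, IsDiffeoBV h ∧ g = h * f * h⁻¹}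

/-- The closure of a set of diffeomorphisms inside `Diff₊^{1+bv}([0,1])`, for the `C^{1+bv}`
topology. -/
def closureBV (A : Set Homeo) : Set Homeo :=
  {g | IsDiffeoBV g ∧ ∀ ε : ENNReal, 0 < ε → ∃ k ∈ A, distBV k g < ε}

/-- `X` is a Szekeres (generating) vector field for `f` on the half-open interval `S`
(`S = [0,1)` or `S = (0,1]`), and `φ` is its flow, `φ t` being the time-`t` map: `X` is `C¹` on
`S` and continuous on `[0,1]`, its flow on `S` is complete, and its time-`1` map is `f`. -/
structure IsSzekeres (f : Homeo) (S : Set ℝ) (X : ℝ → ℝ) (φ : ℝ → ℝ → ℝ) : Prop where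
  contDiffOn : ContDiffOn ℝ 1 X S
  continuousOn : ContinuousOn X (Set.Icc 0 1)
  mapsTo : ∀ t : ℝ, Set.MapsTo (φ t) S S
  map_zero : ∀ x ∈ S, φ 0 x = x
  hasDerivAt : ∀ x ∈ S, ∀ t : ℝ, HasDerivAt (fun s => φ s x) (X (φ t x)) t
  map_one : ∀ x ∈ S, φ 1 x = toFun f x

/-- `M : ℝ → ℝ` is the change of coordinates `M_f^{a,b} = ψ_Y⁻¹ ∘ ψ_X`, where
`ψ_X t = φ t a` and `ψ_Y t = ψ t b`, for the flows `φ` and `ψ` of the generating vector fields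
`X` and `Y` of `f` on `[0,1)` and on `(0,1]` respectively. -/
def IsMatherMap (f : Homeo) (a b : ℝ) (M : ℝ → ℝ) : Prop :=
  ∃ X Y : ℝ → ℝ, ∃ φ ψ : ℝ → ℝ → ℝ,
    IsSzekeres f (Set.Ico 0 1) X φ ∧ IsSzekeres f (Set.Ioc 0 1) Y ψ ∧
      ∀ t : ℝ, ψ (M t) b = φ t a

/-- The Mather invariant of `f`, as a class of maps of the circle `ℝ/ℤ`: the class, modulo pre-
and post-composition with rotations, of the circle maps `m` induced by the `M_f^{a,b}`,
`a, b ∈ (0,1)`. -/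
def matherInvariant (f : Homeo) : Set (UnitAddCircle → UnitAddCircle) :=
  {g | ∃ a ∈ Set.Ioo (0 : ℝ) 1, ∃ b ∈ Set.Ioo (0 : ℝ) 1, ∃ M : ℝ → ℝ, IsMatherMap f a b M ∧
    ∃ m : UnitAddCircle → UnitAddCircle, (∀ t : ℝ, m (t : UnitAddCircle) = (M t : UnitAddCircle)) ∧
    ∃ α β : UnitAddCircle, ∀ x, g x = m (x + α) + β}

/-- The class of rotations of the circle `ℝ/ℤ`. -/
def rotations : Set (UnitAddCircle → UnitAddCircle) :=
  Set.range (fun γ : UnitAddCircle => fun x => x + γ)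

/-- The Mather invariant of `f` is trivial: it is the class of rotations. -/
def MatherTrivial (f : Homeo) : Prop := matherInvariant f = rotations

end IntervalDiffeo

namespace IntervalDiffeo

open Set Filter Topology

/-! The argument runs on the cocycle identity log D(hfh⁻¹)∘h = (log Dh)∘f + log Df − log Dh.
Endpoint derivatives are invariant under conjugacy, so approaching the identity forces Df(0) = Df(1)
= 1. Once Df(0) = 1, conjugates close to the identity are the same as conjugates with small var(log
D) (`HasSmallConjugates`). Passing to f⁻¹ changes neither this variation nor the form of a Mather
map that is a translation, so f may be assumed to move points to the right.

Necessity (`exists_eq_add_const_of_movesRight`): X and Y satisfy the same equation X∘f = Df·X, so R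
= log(X/Y) is f-invariant. Since X and Y have zero derivative at their parabolic endpoints, the
increment of R between two points of a fundamental domain is the limit, up to sign, of the
distortion of f^(2k) between their k-th preimages. For a conjugate g = hfh⁻¹, the contributions of h
to the distortion cancel in the limit, and the distortion of every iterate of g on a fundamental
domain is at most var(log Dg). If this can be made arbitrarily small, R is constant; then Y is a
multiple of X, and commutation of the Mather map with the unit translation makes the factor 1.

Sufficiency (`hasSmallConjugates_of_movesRight`): if the Mather map is a translation then X = Y on
(0,1). Conjugate by h with Dh proportional to Df⁻ᵏ on [0,a] and to Dfᵏ on [a,1], the factors being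
matched at a. Outside one fundamental domain log D of the conjugate only sees log Df near the
endpoints; inside, it is an increment of log X from near 0 to near 1, whose variation is small
because X' tends to 0 at both ends.

The Mather invariant must also be nonempty, so generating vector fields have to be constructed at
parabolic endpoints (`MovesLeft.exists_isSzekeres`), from the limit of log Dfⁿ(x) − log Dfⁿ(a). -/

/-! ### Homeomorphisms of [0,1] as real functions. -/

theorem toFun_coe (f : Homeo) (x : Icc (0 : ℝ) 1) : toFun f x = f x := by
  simp [toFun]

theorem toFun_of_mem (f : Homeo) {x : ℝ} (hx : x ∈ Icc (0 : ℝ) 1) : toFun f x = f ⟨x, hx⟩ :=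
  toFun_coe f ⟨x, hx⟩

theorem toFun_mem (f : Homeo) (x : ℝ) : toFun f x ∈ Icc (0 : ℝ) 1 := by
  unfold toFun IccExtend
  exact Subtype.coe_prop _

theorem toFun_mul (f g : Homeo) (x : ℝ) : toFun (f * g) x = toFun f (toFun g x) := by
  have h : toFun g x = (g (projIcc 0 1 zero_le_one x) : ℝ) := rfl
  rw [h, toFun_coe]
  rfl

theorem toFun_one {x : ℝ} (hx : x ∈ Icc (0 : ℝ) 1) : toFun 1 x = x := by
  rw [toFun_of_mem _ hx]; rfl

theorem toFun_inv_toFun (f : Homeo) {x : ℝ} (hx : x ∈ Icc (0 : ℝ) 1) :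
    toFun f⁻¹ (toFun f x) = x := by
  rw [← toFun_mul, inv_mul_cancel, toFun_one hx]

theorem toFun_toFun_inv (f : Homeo) {x : ℝ} (hx : x ∈ Icc (0 : ℝ) 1) :
    toFun f (toFun f⁻¹ x) = x := by
  rw [← toFun_mul, mul_inv_cancel, toFun_one hx]

theorem strictMonoOn_toFun (f : Homeo) : StrictMonoOn (toFun f) (Icc 0 1) := by
  intro x hx y hy hxy
  rw [toFun_of_mem f hx, toFun_of_mem f hy]
  exact f.strictMono (by simpa using hxy)

theorem continuous_toFun (f : Homeo) : Continuous (toFun f) :=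
  (continuous_subtype_val.comp f.continuous).Icc_extend'

theorem toFun_zero (f : Homeo) : toFun f 0 = 0 := by
  have h0 : (0 : ℝ) ∈ Icc (0 : ℝ) 1 := by simp
  refine le_antisymm ?_ (toFun_mem f 0).1
  have h := (strictMonoOn_toFun f).monotoneOn h0 (toFun_mem f⁻¹ 0) (toFun_mem f⁻¹ 0).1
  rwa [toFun_toFun_inv f h0] at h

theorem toFun_at_one (f : Homeo) : toFun f 1 = 1 := by
  have h0 : (1 : ℝ) ∈ Icc (0 : ℝ) 1 := by simp
  refine le_antisymm (toFun_mem f 1).2 ?_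
  have h := (strictMonoOn_toFun f).monotoneOn (toFun_mem f⁻¹ 1) h0 (toFun_mem f⁻¹ 1).2
  rwa [toFun_toFun_inv f h0] at h

theorem toFun_mem_Ioo (f : Homeo) {x : ℝ} (hx : x ∈ Ioo (0 : ℝ) 1) : toFun f x ∈ Ioo (0 : ℝ) 1 := by
  have hx' := Ioo_subset_Icc_self hx
  constructor
  · have := strictMonoOn_toFun f (by simp) hx' hx.1
    rwa [toFun_zero] at this
  · have := strictMonoOn_toFun f hx' (by simp) hx.2
    rwa [toFun_at_one] at this

theorem uniqueDiffOn_unit : UniqueDiffOn ℝ (Icc (0 : ℝ) 1) := uniqueDiffOn_Icc zero_lt_one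

namespace IsDiffeo

variable {r : ℕ} {f g : Homeo}

theorem inv (hf : IsDiffeo r f) : IsDiffeo r f⁻¹ := ⟨hf.2, by rw [inv_inv]; exact hf.1⟩

theorem mul (hf : IsDiffeo r f) (hg : IsDiffeo r g) : IsDiffeo r (f * g) := by
  constructor
  · exact (hf.1.comp hg.1 fun x _ => toFun_mem g x).congr fun x _ => toFun_mul f g x
  · rw [mul_inv_rev]
    exact (hg.2.comp hf.2 fun x _ => toFun_mem f⁻¹ x).congr fun x _ => toFun_mul g⁻¹ f⁻¹ x

theorem one : IsDiffeo r 1 := by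
  have h : ContDiffOn ℝ r (toFun 1) (Icc 0 1) := contDiffOn_id.congr fun x hx => toFun_one hx
  exact ⟨h, by rwa [inv_one]⟩

theorem pow (hf : IsDiffeo r f) (n : ℕ) : IsDiffeo r (f ^ n) := by
  induction n with
  | zero => rw [pow_zero]; exact one
  | succ n ih => rw [pow_succ]; exact ih.mul hf

theorem conj (hf : IsDiffeo r f) (hg : IsDiffeo r g) : IsDiffeo r (g * f * g⁻¹) :=
  (hg.mul hf).mul hg.inv

theorem of_le {s : ℕ} (hf : IsDiffeo r f) (h : s ≤ r) : IsDiffeo s f :=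
  ⟨hf.1.of_le (by exact_mod_cast h), hf.2.of_le (by exact_mod_cast h)⟩

theorem hasDerivWithinAt (hf : IsDiffeo 1 f) {x : ℝ} (hx : x ∈ Icc (0 : ℝ) 1) :
    HasDerivWithinAt (toFun f) (D f x) (Icc 0 1) x :=
  ((hf.1.differentiableOn (by norm_num)) x hx).hasDerivWithinAt

theorem hasDerivAt (hf : IsDiffeo 1 f) {x : ℝ} (hx : x ∈ Ioo (0 : ℝ) 1) :
    HasDerivAt (toFun f) (D f x) x :=
  (hf.hasDerivWithinAt (Ioo_subset_Icc_self hx)).hasDerivAt (Icc_mem_nhds hx.1 hx.2)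

end IsDiffeo

/-! ### Chain rule and the logarithmic derivative cocycle. -/

theorem D_mul {f g : Homeo} (hf : IsDiffeo 1 f) (hg : IsDiffeo 1 g) {x : ℝ}
    (hx : x ∈ Icc (0 : ℝ) 1) : D (f * g) x = D f (toFun g x) * D g x := by
  have h := (hf.hasDerivWithinAt (toFun_mem g x)).comp x (hg.hasDerivWithinAt hx)
    fun x _ => toFun_mem g x
  exact (h.congr (fun y _ => toFun_mul f g y) (toFun_mul f g x)).derivWithin
    (uniqueDiffOn_unit x hx)

theorem D_one {x : ℝ} (hx : x ∈ Icc (0 : ℝ) 1) : D 1 x = 1 :=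
  ((hasDerivWithinAt_id x _).congr (fun _ hy => toFun_one hy) (toFun_one hx)).derivWithin
    (uniqueDiffOn_unit x hx)

theorem IsDiffeo.D_pos {f : Homeo} (hf : IsDiffeo 1 f) {x : ℝ} (hx : x ∈ Icc (0 : ℝ) 1) :
    0 < D f x := by
  have h1 : D f⁻¹ (toFun f x) * D f x = 1 := by
    rw [← D_mul hf.inv hf hx, inv_mul_cancel, D_one hx]
  have h2 : 0 ≤ D f x := (strictMonoOn_toFun f).monotoneOn.derivWithin_nonneg
  refine h2.lt_of_ne fun h => ?_
  rw [← h, mul_zero] at h1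
  exact zero_ne_one h1

theorem IsDiffeo.continuousOn_D {f : Homeo} (hf : IsDiffeo 1 f) : ContinuousOn (D f) (Icc 0 1) :=
  hf.1.continuousOn_derivWithin uniqueDiffOn_unit (by norm_num)

/-- The logarithm of the derivative. -/
noncomputable def logD (f : Homeo) (x : ℝ) : ℝ := Real.log (D f x)

theorem IsDiffeo.continuousOn_logD {f : Homeo} (hf : IsDiffeo 1 f) :
    ContinuousOn (logD f) (Icc 0 1) :=
  hf.continuousOn_D.log fun _ hx => (hf.D_pos hx).ne'

theorem logD_mul {f g : Homeo} (hf : IsDiffeo 1 f) (hg : IsDiffeo 1 g) {x : ℝ}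
    (hx : x ∈ Icc (0 : ℝ) 1) : logD (f * g) x = logD f (toFun g x) + logD g x := by
  unfold logD
  rw [D_mul hf hg hx, Real.log_mul (hf.D_pos (toFun_mem g x)).ne' (hg.D_pos hx).ne']

theorem logD_one {x : ℝ} (hx : x ∈ Icc (0 : ℝ) 1) : logD 1 x = 0 := by
  rw [logD, D_one hx, Real.log_one]

theorem logD_inv {f : Homeo} (hf : IsDiffeo 1 f) {x : ℝ} (hx : x ∈ Icc (0 : ℝ) 1) :
    logD f⁻¹ x = -logD f (toFun f⁻¹ x) := by
  have h := logD_mul hf hf.inv hx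
  rw [mul_inv_cancel, logD_one hx] at h
  linarith

theorem exp_logD {f : Homeo} (hf : IsDiffeo 1 f) {x : ℝ} (hx : x ∈ Icc (0 : ℝ) 1) :
    Real.exp (logD f x) = D f x := Real.exp_log (hf.D_pos hx)

theorem logD_eq_zero_iff {f : Homeo} (hf : IsDiffeo 1 f) {x : ℝ} (hx : x ∈ Icc (0 : ℝ) 1) :
    logD f x = 0 ↔ D f x = 1 := by
  refine ⟨fun h => ?_, fun h => by rw [logD, h, Real.log_one]⟩
  rw [← exp_logD hf hx, h, Real.exp_zero]

/-- The logarithmic derivative of a conjugate, at the image of a point. -/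
theorem logD_conj {f h : Homeo} (hf : IsDiffeo 1 f) (hh : IsDiffeo 1 h) {x : ℝ}
    (hx : x ∈ Icc (0 : ℝ) 1) :
    logD (h * f * h⁻¹) (toFun h x) = logD h (toFun f x) + logD f x - logD h x := by
  rw [logD_mul (hh.mul hf) hh.inv (toFun_mem h x), toFun_inv_toFun h hx, logD_mul hh hf hx,
    logD_inv hh (toFun_mem h x), toFun_inv_toFun h hx]
  ring

theorem D_conj_of_fixed {f h : Homeo} (hf : IsDiffeo 1 f) (hh : IsDiffeo 1 h) {x : ℝ}
    (hx : x ∈ Icc (0 : ℝ) 1) (hhx : toFun h x = x) (hfx : toFun f x = x) :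
    D (h * f * h⁻¹) x = D f x := by
  have hc := hf.conj hh
  rw [← exp_logD hc hx, ← exp_logD hf hx]
  have := logD_conj hf hh hx
  rw [hhx, hfx] at this
  rw [this]; congr 1; ring

theorem IsDiffeo.contDiffOn_logD {f : Homeo} (hf : IsDiffeo 2 f) :
    ContDiffOn ℝ 1 (logD f) (Icc 0 1) := by
  have h1 : ContDiffOn ℝ 1 (D f) (Icc 0 1) :=
    hf.1.derivWithin uniqueDiffOn_unit (by norm_num)
  exact h1.log fun x hx => ((hf.of_le one_le_two).D_pos hx).ne'

theorem ContDiffOn.exists_lipschitzOnWith_Icc {u : ℝ → ℝ} {a b : ℝ}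
    (hu : ContDiffOn ℝ 1 u (Icc a b)) : ∃ K, LipschitzOnWith K u (Icc a b) :=
  hu.exists_lipschitzOnWith one_ne_zero (convex_Icc a b) isCompact_Icc

theorem IsDiffeo.exists_lipschitzOnWith_logD {f : Homeo} (hf : IsDiffeo 2 f) :
    ∃ K, LipschitzOnWith K (logD f) (Icc 0 1) :=
  ContDiffOn.exists_lipschitzOnWith_Icc hf.contDiffOn_logD

/-! ### Total variation under reparametrisation. -/

theorem toFun_image_Icc (f : Homeo) {a b : ℝ} (ha : a ∈ Icc (0 : ℝ) 1) (hb : b ∈ Icc (0 : ℝ) 1) :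
    toFun f '' Icc a b = Icc (toFun f a) (toFun f b) := by
  have hsub : Icc a b ⊆ Icc 0 1 := Icc_subset_Icc ha.1 hb.2
  ext y
  constructor
  · rintro ⟨x, hx, rfl⟩
    exact ⟨(strictMonoOn_toFun f).monotoneOn ha (hsub hx) hx.1,
      (strictMonoOn_toFun f).monotoneOn (hsub hx) hb hx.2⟩
  · rintro ⟨h1, h2⟩
    have hy : y ∈ Icc (0 : ℝ) 1 := ⟨(toFun_mem f a).1.trans h1, h2.trans (toFun_mem f b).2⟩
    refine ⟨toFun f⁻¹ y, ⟨?_, ?_⟩, toFun_toFun_inv f hy⟩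
    · rw [← toFun_inv_toFun f ha]
      exact (strictMonoOn_toFun f⁻¹).monotoneOn (toFun_mem f a) hy h1
    · rw [← toFun_inv_toFun f hb]
      exact (strictMonoOn_toFun f⁻¹).monotoneOn hy (toFun_mem f b) h2

theorem eVariationOn_comp_toFun (u : ℝ → ℝ) (f : Homeo) {a b : ℝ} (ha : a ∈ Icc (0 : ℝ) 1)
    (hb : b ∈ Icc (0 : ℝ) 1) :
    eVariationOn (fun x => u (toFun f x)) (Icc a b)
      = eVariationOn u (Icc (toFun f a) (toFun f b)) := by
  rw [← toFun_image_Icc f ha hb]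
  exact eVariationOn.comp_eq_of_monotoneOn u _
    ((strictMonoOn_toFun f).monotoneOn.mono (Icc_subset_Icc ha.1 hb.2))

theorem eVariationOn_comp_toFun_unit (u : ℝ → ℝ) (f : Homeo) :
    eVariationOn (fun x => u (toFun f x)) (Icc 0 1) = eVariationOn u (Icc 0 1) := by
  rw [eVariationOn_comp_toFun u f (by simp) (by simp), toFun_zero, toFun_at_one]

/-- Since log Df⁻¹ = −(log Df)∘f⁻¹, this is reparametrisation invariance; it allows f to be replaced
by f⁻¹ throughout. -/
theorem eVariationOn_logD_inv {f : Homeo} (hf : IsDiffeo 1 f) :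
    eVariationOn (logD f⁻¹) (Icc 0 1) = eVariationOn (logD f) (Icc 0 1) := by
  have h1 : eVariationOn (logD f⁻¹) (Icc 0 1)
      = eVariationOn (fun x => logD f (toFun f⁻¹ x)) (Icc 0 1) := by
    unfold eVariationOn
    congr 1; ext p; refine Finset.sum_congr rfl fun i _ => ?_
    rw [logD_inv hf (p.2.2.2 _), logD_inv hf (p.2.2.2 _), edist_neg_neg]
  rw [h1, eVariationOn_comp_toFun_unit]

/-! ### Generating vector fields and their flows. -/

/-- A C¹ field on a non-compact interval need not be Lipschitz. Over a bounded time interval both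
curves stay in a compact subinterval of S, where it is, and Lipschitz uniqueness applies there. -/
theorem eq_of_hasDerivAt_vectorField {S : Set ℝ} (hS : S.OrdConnected) {X : ℝ → ℝ}
    (hX : ContDiffOn ℝ 1 X S) {γ η : ℝ → ℝ} (hγ : ∀ t, HasDerivAt γ (X (γ t)) t)
    (hγS : ∀ t, γ t ∈ S) (hη : ∀ t, HasDerivAt η (X (η t)) t) (hηS : ∀ t, η t ∈ S) {t₀ : ℝ}
    (h : γ t₀ = η t₀) : γ = η := by
  ext t
  obtain ⟨A, B, ht, ht₀⟩ : ∃ A B, t ∈ Ioo A B ∧ t₀ ∈ Ioo A B := by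
    use (min (-|t|) (-|t₀|) - 1), (max |t| |t₀| + 1)
    grind
  have hγc : Continuous γ := continuous_iff_continuousAt.2 fun t => (hγ t).continuousAt
  have hηc : Continuous η := continuous_iff_continuousAt.2 fun t => (hη t).continuousAt
  have hcomp : IsCompact (γ '' Icc A B ∪ η '' Icc A B) :=
    (isCompact_Icc.image hγc).union (isCompact_Icc.image hηc)
  have hne : (γ '' Icc A B ∪ η '' Icc A B).Nonempty :=
    ⟨γ t, Or.inl (mem_image_of_mem _ (Ioo_subset_Icc_self ht))⟩
  have hsub : γ '' Icc A B ∪ η '' Icc A B ⊆ S := by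
    rintro _ (⟨s, -, rfl⟩ | ⟨s, -, rfl⟩)
    exacts [hγS s, hηS s]
  obtain ⟨m, hm, hm'⟩ := hcomp.exists_isLeast hne
  obtain ⟨M, hM, hM'⟩ := hcomp.exists_isGreatest hne
  obtain ⟨K, hK⟩ := ContDiffOn.exists_lipschitzOnWith_Icc
    (hX.mono (hS.out (hsub hm) (hsub hM)))
  refine ODE_solution_unique_of_mem_Ioo (v := fun _ => X) (s := fun _ => Icc m M)
    (fun _ _ => hK) ht₀ (fun s hs => ⟨hγ s, ?_⟩) (fun s hs => ⟨hη s, ?_⟩) h ht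
  · have : γ s ∈ γ '' Icc A B ∪ η '' Icc A B :=
      Or.inl (mem_image_of_mem _ (Ioo_subset_Icc_self hs))
    exact ⟨hm' this, hM' this⟩
  · have : η s ∈ γ '' Icc A B ∪ η '' Icc A B :=
      Or.inr (mem_image_of_mem _ (Ioo_subset_Icc_self hs))
    exact ⟨hm' this, hM' this⟩

/-- Intervals with endpoints `0` and `1`. -/
structure IsUnitInterval (S : Set ℝ) : Prop where
  ordConnected : S.OrdConnected
  Ioo_subset : Ioo 0 1 ⊆ S
  subset_Icc : S ⊆ Icc 0 1

theorem isUnitInterval_Ico : IsUnitInterval (Ico 0 1) :=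
  ⟨ordConnected_Ico, Ioo_subset_Ico_self, Ico_subset_Icc_self⟩

theorem isUnitInterval_Ioc : IsUnitInterval (Ioc 0 1) :=
  ⟨ordConnected_Ioc, Ioo_subset_Ioc_self, Ioc_subset_Icc_self⟩

theorem NoInteriorFixedPoint.toFun_ne {f : Homeo} (hf : NoInteriorFixedPoint f) {x : ℝ}
    (hx : x ∈ Ioo (0 : ℝ) 1) : toFun f x ≠ x := fun h => by
  refine hf ⟨x, Ioo_subset_Icc_self hx⟩ hx.1 hx.2 (Subtype.ext ?_)
  rwa [← toFun_of_mem f (Ioo_subset_Icc_self hx)]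

/-- `f` moves the points of `(0,1)` to the right. -/
def MovesRight (f : Homeo) : Prop := ∀ x ∈ Ioo (0 : ℝ) 1, x < toFun f x

theorem MovesRight.noInteriorFixedPoint {f : Homeo} (hf : MovesRight f) :
    NoInteriorFixedPoint f := fun x h0 h1 h => by
  have := hf x ⟨h0, h1⟩
  rw [toFun_coe, h] at this
  exact lt_irrefl _ this

/-- If both alternatives failed, f(x) − x would change sign and vanish somewhere in (0,1) by the
intermediate value theorem. -/
theorem NoInteriorFixedPoint.movesRight_or {f : Homeo} (hf : NoInteriorFixedPoint f) :
    MovesRight f ∨ MovesRight f⁻¹ := by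
  by_contra! hcon
  unfold MovesRight at hcon
  push Not at hcon
  obtain ⟨⟨x, hx, hx'⟩, y, hy, hy'⟩ := hcon
  have hz : toFun f⁻¹ y ∈ Ioo (0 : ℝ) 1 := toFun_mem_Ioo _ hy
  have h1 : toFun f (toFun f⁻¹ y) = y := toFun_toFun_inv f (Ioo_subset_Icc_self hy)
  have hc : ContinuousOn (fun t => toFun f t - t) (Ioo 0 1) :=
    ((continuous_toFun f).sub continuous_id).continuousOn
  obtain ⟨t, ht, ht'⟩ := (isPreconnected_Ioo (a := (0 : ℝ)) (b := 1)).intermediate_value hx hz hc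
    (show (0 : ℝ) ∈ Icc _ _ from ⟨by linarith, by simp only [h1]; linarith⟩)
  exact hf.toFun_ne ht (by simp only at ht'; linarith)

namespace IsSzekeres

variable {f : Homeo} {S : Set ℝ} {X : ℝ → ℝ} {φ : ℝ → ℝ → ℝ}

theorem flow_add (h : IsSzekeres f S X φ) (hS : IsUnitInterval S) {x : ℝ} (hx : x ∈ S) (s t : ℝ) :
    φ (s + t) x = φ t (φ s x) := by
  have := eq_of_hasDerivAt_vectorField hS.ordConnected h.contDiffOn
    (γ := fun t => φ (s + t) x) (η := fun t => φ t (φ s x)) (t₀ := 0)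
    (fun t => (h.hasDerivAt x hx (s + t)).comp_const_add s t)
    (fun t => h.mapsTo _ hx) (fun t => h.hasDerivAt _ (h.mapsTo s hx) t)
    (fun t => h.mapsTo _ (h.mapsTo _ hx))
    (by simp only [add_zero]; rw [h.map_zero _ (h.mapsTo s hx)])
  exact congrFun this t

theorem flow_add_one (h : IsSzekeres f S X φ) (hS : IsUnitInterval S) {x : ℝ} (hx : x ∈ S)
    (t : ℝ) : φ (t + 1) x = toFun f (φ t x) := by
  rw [h.flow_add hS hx, h.map_one _ (h.mapsTo t hx)]

theorem flow_eq_self (h : IsSzekeres f S X φ) (hS : IsUnitInterval S) {x : ℝ} (hx : x ∈ S)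
    {s : ℝ} (h0 : X (φ s x) = 0) (t : ℝ) : φ t x = φ s x := by
  have := eq_of_hasDerivAt_vectorField hS.ordConnected h.contDiffOn
    (γ := fun t => φ t x) (η := fun _ => φ s x) (t₀ := s)
    (fun t => h.hasDerivAt x hx t) (fun t => h.mapsTo _ hx)
    (fun t => by rw [h0]; exact hasDerivAt_const _ _) (fun t => h.mapsTo _ hx) rfl
  exact congrFun this t

theorem ne_zero (h : IsSzekeres f S X φ) (hS : IsUnitInterval S) (hf : NoInteriorFixedPoint f)
    {x : ℝ} (hx : x ∈ Ioo (0 : ℝ) 1) : X x ≠ 0 := fun h0 => by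
  have hxS := hS.Ioo_subset hx
  have := h.flow_eq_self hS hxS (s := 0) (by rwa [h.map_zero x hxS]) 1
  rw [h.map_one x hxS, h.map_zero x hxS] at this
  exact hf.toFun_ne hx this

/-- An orbit reaching 0 or 1 has an extremum there, so the field vanishes at that point and the
orbit is constant by uniqueness, contradicting x ∈ (0,1). -/
theorem flow_mem_Ioo (h : IsSzekeres f S X φ) (hS : IsUnitInterval S) {x : ℝ}
    (hx : x ∈ Ioo (0 : ℝ) 1) (t : ℝ) : φ t x ∈ Ioo (0 : ℝ) 1 := by
  have hxS := hS.Ioo_subset hx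
  have hmem : ∀ s, φ s x ∈ Icc (0 : ℝ) 1 := fun s => hS.subset_Icc (h.mapsTo s hxS)
  have key : X (φ t x) = 0 → φ t x = x := fun h0 => by
    rw [← h.flow_eq_self hS hxS h0 0, h.map_zero x hxS]
  refine ⟨(hmem t).1.lt_of_ne fun h0 => ?_, (hmem t).2.lt_of_ne fun h0 => ?_⟩
  · have hmin : IsLocalMin (fun s => φ s x) t := Eventually.of_forall fun s => by
      simp only [← h0]; exact (hmem s).1
    have := key (hmin.hasDerivAt_eq_zero (h.hasDerivAt x hxS t))
    rw [← h0] at this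
    exact hx.1.ne this
  · have hmax : IsLocalMax (fun s => φ s x) t := Eventually.of_forall fun s => by
      simp only [h0]; exact (hmem s).2
    have := key (hmax.hasDerivAt_eq_zero (h.hasDerivAt x hxS t))
    rw [h0] at this
    exact hx.2.ne' this

theorem inv (h : IsSzekeres f S X φ) (hS : IsUnitInterval S) :
    IsSzekeres f⁻¹ S (fun x => -X x) (fun t => φ (-t)) where
  contDiffOn := h.contDiffOn.neg
  continuousOn := h.continuousOn.neg
  mapsTo t := h.mapsTo (-t)
  map_zero x hx := by rw [neg_zero, h.map_zero x hx]
  hasDerivAt x hx t := by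
    have := (h.hasDerivAt x hx (-t)).scomp t (hasDerivAt_neg t)
    simpa [Function.comp_def] using this
  map_one x hx := by
    have h1 := h.flow_add_one hS hx (-1)
    rw [neg_add_cancel, h.map_zero x hx] at h1
    conv_rhs => rw [h1]
    rw [toFun_inv_toFun f (hS.subset_Icc (h.mapsTo _ hx))]

theorem continuous_flow (h : IsSzekeres f S X φ) {x : ℝ} (hx : x ∈ S) :
    Continuous fun t => φ t x :=
  continuous_iff_continuousAt.2 fun t => (h.hasDerivAt x hx t).continuousAt

/-- The derivative of the orbit never vanishes, so by Darboux it has constant sign; a negative sign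
would give f(x) < x. -/
theorem flow_pos (h : IsSzekeres f S X φ) (hS : IsUnitInterval S) (hf : MovesRight f) {x : ℝ}
    (hx : x ∈ Ioo (0 : ℝ) 1) (t : ℝ) : 0 < X (φ t x) := by
  have hxS := hS.Ioo_subset hx
  rcases hasDerivWithinAt_forall_lt_or_forall_gt_of_forall_ne (m := 0) (f := fun t => φ t x)
    convex_univ (fun t _ => (h.hasDerivAt x hxS t).hasDerivWithinAt)
    (fun t _ => h.ne_zero hS hf.noInteriorFixedPoint (h.flow_mem_Ioo hS hx t)) with h1 | h1
  · have hanti : StrictAnti fun t => φ t x := strictAnti_of_hasDerivAt_neg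
      (fun t => h.hasDerivAt x hxS t) (fun t => h1 t (mem_univ t))
    have h2 := hanti zero_lt_one
    simp only [h.map_zero x hxS, h.map_one x hxS] at h2
    exact absurd h2 (hf x hx).not_gt
  · exact h1 t (mem_univ t)

theorem strictMono_flow (h : IsSzekeres f S X φ) (hS : IsUnitInterval S) (hf : MovesRight f)
    {x : ℝ} (hx : x ∈ Ioo (0 : ℝ) 1) : StrictMono fun t => φ t x :=
  strictMono_of_hasDerivAt_pos (fun t => h.hasDerivAt x (hS.Ioo_subset hx) t)
    (h.flow_pos hS hf hx)

theorem tendsto_flow_atTop (h : IsSzekeres f S X φ) (hS : IsUnitInterval S) (hf : MovesRight f)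
    {x : ℝ} (hx : x ∈ Ioo (0 : ℝ) 1) : Tendsto (fun t => φ t x) atTop (𝓝 1) := by
  have hm := h.flow_mem_Ioo hS hx
  have hbdd : BddAbove (range fun t => φ t x) := ⟨1, by rintro _ ⟨t, rfl⟩; exact (hm t).2.le⟩
  -- The orbit is monotone, and its limit is a fixed point of f, hence not interior.
  have hlim := tendsto_atTop_ciSup (h.strictMono_flow hS hf hx).monotone hbdd
  set L := ⨆ t, φ t x
  have h1 : φ 0 x ≤ L := le_ciSup hbdd 0
  have h2 : L ≤ 1 := ciSup_le fun t => (hm t).2.le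
  have h3 : toFun f L = L := by
    refine tendsto_nhds_unique (((continuous_toFun f).tendsto L).comp hlim) ?_
    refine (hlim.comp (tendsto_atTop_add_const_right atTop 1 tendsto_id)).congr fun t => ?_
    simp [h.flow_add_one hS (hS.Ioo_subset hx)]
  rcases h2.eq_or_lt with h4 | h4
  · rwa [h4] at hlim
  · exact absurd h3 (hf L ⟨(hm 0).1.trans_le h1, h4⟩).ne'

theorem tendsto_flow_atBot (h : IsSzekeres f S X φ) (hS : IsUnitInterval S) (hf : MovesRight f)
    {x : ℝ} (hx : x ∈ Ioo (0 : ℝ) 1) : Tendsto (fun t => φ t x) atBot (𝓝 0) := by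
  have hm := h.flow_mem_Ioo hS hx
  have hbdd : BddBelow (range fun t => φ t x) := ⟨0, by rintro _ ⟨t, rfl⟩; exact (hm t).1.le⟩
  have hlim := tendsto_atBot_ciInf (h.strictMono_flow hS hf hx).monotone hbdd
  set L := ⨅ t, φ t x
  have h1 : L ≤ φ 0 x := ciInf_le hbdd 0
  have h2 : 0 ≤ L := le_ciInf fun t => (hm t).1.le
  have h3 : toFun f L = L := by
    refine tendsto_nhds_unique (((continuous_toFun f).tendsto L).comp hlim) ?_
    refine (hlim.comp (tendsto_atBot_add_const_right atBot 1 tendsto_id)).congr fun t => ?_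
    simp [h.flow_add_one hS (hS.Ioo_subset hx)]
  rcases h2.eq_or_lt with h4 | h4
  · rwa [← h4] at hlim
  · exact absurd h3 (hf L ⟨h4, h1.trans_lt (hm 0).2⟩).ne'

theorem exists_flow_eq (h : IsSzekeres f S X φ) (hS : IsUnitInterval S) (hf : MovesRight f)
    {x y : ℝ} (hx : x ∈ Ioo (0 : ℝ) 1) (hy : y ∈ Ioo (0 : ℝ) 1) : ∃ t, φ t x = y := by
  obtain ⟨t, ht⟩ := ((h.tendsto_flow_atBot hS hf hx).eventually (gt_mem_nhds hy.1)).exists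
  obtain ⟨s, hs⟩ := ((h.tendsto_flow_atTop hS hf hx).eventually (lt_mem_nhds hy.2)).exists
  exact mem_range_of_exists_le_of_exists_ge (h.continuous_flow (hS.Ioo_subset hx)) ⟨t, ht.le⟩
    ⟨s, hs.le⟩

theorem hasDerivAt_log (h : IsSzekeres f S X φ) (hS : IsUnitInterval S) (hf : MovesRight f)
    {x : ℝ} (hx : x ∈ Ioo (0 : ℝ) 1) (t : ℝ) :
    HasDerivAt (fun t => Real.log (X (φ t x))) (derivWithin X S (φ t x)) t := by
  have hmem := h.flow_mem_Ioo hS hx t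
  have hpos := h.flow_pos hS hf hx t
  have hX : HasDerivAt X (derivWithin X S (φ t x)) (φ t x) :=
    ((h.contDiffOn.differentiableOn (by norm_num)) _
      (hS.Ioo_subset hmem)).hasDerivWithinAt.hasDerivAt
      (mem_of_superset (Ioo_mem_nhds hmem.1 hmem.2) hS.Ioo_subset)
  have := (hX.comp t (h.hasDerivAt x (hS.Ioo_subset hx) t)).log hpos.ne'
  simp only [Function.comp_def] at this
  rwa [mul_div_cancel_right₀ _ hpos.ne'] at this

/-- The logarithmic derivative of `f` in terms of a generating vector field. -/
theorem logD_eq (h : IsSzekeres f S X φ) (hS : IsUnitInterval S) (hf : MovesRight f)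
    (hf1 : IsDiffeo 1 f) {x : ℝ} (hx : x ∈ Ioo (0 : ℝ) 1) (t : ℝ) :
    logD f (φ t x) = Real.log (X (φ (t + 1) x)) - Real.log (X (φ t x)) := by
  have hxS := hS.Ioo_subset hx
  have h1 := (hf1.hasDerivAt (h.flow_mem_Ioo hS hx t)).comp t (h.hasDerivAt x hxS t)
  have h2 := (h.hasDerivAt x hxS (t + 1)).comp_add_const t 1
  have h3 : toFun f ∘ (fun t => φ t x) = fun t => φ (t + 1) x := by
    ext t; exact (h.flow_add_one hS hxS t).symm
  rw [h3] at h1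
  have h4 := h1.unique h2
  have hD := hf1.D_pos (Ioo_subset_Icc_self (h.flow_mem_Ioo hS hx t))
  rw [← h4, Real.log_mul hD.ne' (h.flow_pos hS hf hx t).ne', logD]
  ring

end IsSzekeres

/-! ### Behaviour of log X along orbits near a parabolic endpoint. -/

/-- Mean value theorem on `[t, t + s]`, along a filter at infinity. -/
theorem exists_tendsto_slope {u w : ℝ → ℝ} (hu : ∀ t, HasDerivAt u (w t) t) {l : Filter ℝ}
    (hl : l = atBot ∨ l = atTop) {s : ℝ} (hs : 0 < s) :
    ∃ c : ℝ → ℝ, Tendsto c l l ∧ ∀ t, u (t + s) - u t = s * w (c t) := by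
  have : ∀ t, ∃ c ∈ Ioo t (t + s), w c = (u (t + s) - u t) / (t + s - t) := fun t =>
    exists_hasDerivAt_eq_slope u w (by linarith)
      (fun x _ => (hu x).continuousAt.continuousWithinAt) (fun x _ => hu x)
  choose c hc hc' using this
  refine ⟨c, ?_, fun t => ?_⟩
  · rcases hl with rfl | rfl
    · exact tendsto_atBot_mono (fun t => (hc t).2.le) (tendsto_atBot_add_const_right _ s tendsto_id)
    · exact tendsto_atTop_mono (fun t => (hc t).1.le) tendsto_id
  · rw [hc', add_sub_cancel_left]; field_simp

theorem tendsto_sub_of_deriv_tendsto_zero {u w : ℝ → ℝ} (hu : ∀ t, HasDerivAt u (w t) t)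
    {l : Filter ℝ} (hl : l = atBot ∨ l = atTop) (hw : Tendsto w l (𝓝 0)) {s : ℝ} (hs : 0 ≤ s) :
    Tendsto (fun t => u (t + s) - u t) l (𝓝 0) := by
  rcases hs.eq_or_lt with rfl | hs
  · simpa using tendsto_const_nhds
  · obtain ⟨c, hc, hc'⟩ := exists_tendsto_slope hu hl hs
    simp_rw [hc']
    simpa using (hw.comp hc).const_mul s

namespace IsSzekeres

variable {f : Homeo} {S : Set ℝ} {X : ℝ → ℝ} {φ : ℝ → ℝ → ℝ}

/-- The increment of log X over unit time is log Df, and its derivative in time is X'. By the mean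
value theorem log Df and X' have the same limit at e, so X'(e) = log Df(e) = 0. -/
theorem tendsto_derivWithin (h : IsSzekeres f S X φ) (hS : IsUnitInterval S) (hf : MovesRight f)
    (hf1 : IsDiffeo 1 f) {x : ℝ} (hx : x ∈ Ioo (0 : ℝ) 1) {l : Filter ℝ}
    (hl : l = atBot ∨ l = atTop) {e : ℝ} (he : e ∈ S) (hle : Tendsto (fun t => φ t x) l (𝓝 e))
    (hpar : logD f e = 0) : Tendsto (fun t => derivWithin X S (φ t x)) l (𝓝 0) := by
  have hl' : l.NeBot := by rcases hl with rfl | rfl <;> infer_instance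
  have hxS := hS.Ioo_subset hx
  have hne : (interior S).Nonempty :=
    ⟨x, mem_interior_iff_mem_nhds.2 (mem_of_superset (Ioo_mem_nhds hx.1 hx.2) hS.Ioo_subset)⟩
  have hc : ContinuousOn (derivWithin X S) S :=
    h.contDiffOn.continuousOn_derivWithin
      (uniqueDiffOn_convex hS.ordConnected.convex hne) (by norm_num)
  have h1 : Tendsto (fun t => derivWithin X S (φ t x)) l (𝓝 (derivWithin X S e)) :=
    (hc e he).tendsto.comp (tendsto_nhdsWithin_iff.2
      ⟨hle, Eventually.of_forall fun t => h.mapsTo t hxS⟩)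
  have h2 : Tendsto (fun t => logD f (φ t x)) l (𝓝 (logD f e)) :=
    (hf1.continuousOn_logD e (hS.subset_Icc he)).tendsto.comp (tendsto_nhdsWithin_iff.2
      ⟨hle, Eventually.of_forall fun t => hS.subset_Icc (h.mapsTo t hxS)⟩)
  obtain ⟨c, hc, hc'⟩ := exists_tendsto_slope (h.hasDerivAt_log hS hf hx) hl zero_lt_one
  have h3 : (fun t => logD f (φ t x)) = fun t => derivWithin X S (φ (c t) x) := by
    ext t; rw [h.logD_eq hS hf hf1 hx, hc', one_mul]
  rw [h3] at h2
  have h4 := tendsto_nhds_unique h2 (h1.comp hc)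
  rwa [← h4, hpar] at h1

end IsSzekeres

/-! ### From closeness to the identity to small variation of log D, and back. -/

/-- The conjugates of `f` have logarithmic derivatives of arbitrarily small variation. -/
def HasSmallConjugates (f : Homeo) : Prop :=
  ∀ ε : ENNReal, 0 < ε → ∃ h : Homeo, IsDiffeoBV h ∧
    eVariationOn (logD (h * f * h⁻¹)) (Icc 0 1) ≤ ε

theorem HasSmallConjugates.of_inv {f : Homeo} (hf : IsDiffeo 1 f) (h : HasSmallConjugates f⁻¹) :
    HasSmallConjugates f := fun ε hε => by
  obtain ⟨k, hk, hk'⟩ := h ε hε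
  refine ⟨k, hk, ?_⟩
  rwa [← eVariationOn_logD_inv (hf.conj hk.1),
    show (k * f * k⁻¹)⁻¹ = k * f⁻¹ * k⁻¹ by group]

theorem eVariationOn_D_sub_D_one (k : Homeo) :
    eVariationOn (fun x => D k x - D 1 x) (Icc 0 1) = eVariationOn (D k) (Icc 0 1) := by
  rw [eVariationOn.congr (g := fun x => D k x - 1) fun x hx => by simp only [D_one hx]]
  unfold eVariationOn
  simp only [edist_sub_right]

theorem edist_D_le_distBV (k g : Homeo) {x : ℝ} (hx : x ∈ Icc (0 : ℝ) 1) :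
    edist (D k x) (D g x) ≤ distBV k g :=
  calc edist (D k x) (D g x) ≤ ⨆ x ∈ Icc (0 : ℝ) 1, edist (D k x) (D g x) :=
        le_iSup₂ (f := fun x (_ : x ∈ Icc (0 : ℝ) 1) => edist (D k x) (D g x)) x hx
    _ ≤ distBV k g := le_add_right le_add_self

theorem lipschitzOnWith_log : LipschitzOnWith 2 Real.log (Ici (1 / 2)) := by
  refine (convex_Ici _).lipschitzOnWith_of_nnnorm_deriv_le (fun x hx => ?_) fun x hx => ?_
  · have : (1 / 2 : ℝ) ≤ x := hx
    exact Real.differentiableAt_log (by linarith)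
  · have : (1 / 2 : ℝ) ≤ x := hx
    rw [Real.deriv_log, ← NNReal.coe_le_coe, coe_nnnorm, Real.norm_eq_abs, abs_inv,
      abs_of_pos (by linarith)]
    exact inv_le_of_inv_le₀ (by norm_num) (by norm_num; linarith)

theorem lipschitzOnWith_exp : LipschitzOnWith 3 Real.exp (Iic 1) := by
  refine (convex_Iic _).lipschitzOnWith_of_nnnorm_deriv_le (fun x _ => Real.differentiableAt_exp)
    fun x hx => ?_
  rw [Real.deriv_exp, ← NNReal.coe_le_coe, coe_nnnorm, Real.norm_eq_abs, Real.abs_exp]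
  have h1 : Real.exp x ≤ Real.exp 1 := Real.exp_le_exp.2 hx
  have h2 := Real.exp_one_lt_d9
  push_cast
  linarith

theorem HasSmallConjugates.of_mem_closureBV {f : Homeo}
    (h : 1 ∈ closureBV (conjClassBV f)) : HasSmallConjugates f := fun ε hε => by
  -- The bound 1/2 keeps Dk ≥ 1/2, where log is 2-Lipschitz; the bound ε/2 absorbs the factor 2.
  have hε' : 0 < min (ε / 2) (ENNReal.ofReal (1 / 2)) :=
    lt_min (ENNReal.half_pos hε.ne') (by simp)
  obtain ⟨k, ⟨g, hg, rfl⟩, hk⟩ := h.2 _ hε'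
  refine ⟨g, hg, ?_⟩
  set k := g * f * g⁻¹
  have hmaps : MapsTo (D k) (Icc 0 1) (Ici (1 / 2)) := fun x hx => by
    have h1 := ((edist_D_le_distBV k 1 hx).trans hk.le).trans (min_le_right _ _)
    rw [D_one hx, edist_le_ofReal (by norm_num), Real.dist_eq] at h1
    have := (abs_le.1 h1).1
    simp only [mem_Ici]; linarith
  calc eVariationOn (logD k) (Icc 0 1) ≤ 2 * eVariationOn (D k) (Icc 0 1) :=
        lipschitzOnWith_log.comp_eVariationOn_le hmaps
    _ ≤ 2 * distBV k 1 := by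
        rw [← eVariationOn_D_sub_D_one]; gcongr; exact le_add_self
    _ ≤ 2 * (ε / 2) := by gcongr; exact hk.le.trans (min_le_left _ _)
    _ = ε := ENNReal.mul_div_cancel (by simp) (by simp)

/-- Every conjugate of f has derivative Df(x) at the common fixed point x, so its distance to the
identity is at least |Df(x) − 1|. -/
theorem D_eq_one_of_mem_closureBV {f : Homeo} (hf : IsDiffeo 1 f)
    (h : 1 ∈ closureBV (conjClassBV f)) {x : ℝ} (hx : x ∈ Icc (0 : ℝ) 1)
    (hfix : ∀ g : Homeo, toFun g x = x) : D f x = 1 := by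
  by_contra hne
  obtain ⟨k, ⟨g, hg, rfl⟩, hk⟩ := h.2 (edist (D f x) 1) (edist_pos.2 hne)
  have h1 := edist_D_le_distBV (g * f * g⁻¹) 1 hx
  rw [D_one hx, D_conj_of_fixed hf hg.1 hx (hfix g) (hfix f)] at h1
  exact absurd hk h1.not_gt

theorem isDiffeoBV_one : IsDiffeoBV 1 := by
  refine ⟨IsDiffeo.one, ?_⟩
  unfold BoundedVariationOn
  rw [eVariationOn.congr (g := fun _ => (1 : ℝ)) fun x hx => D_one hx,
    eVariationOn.constant_on (by rintro _ ⟨_, _, rfl⟩ _ ⟨_, _, rfl⟩; rfl)]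
  simp

/-- As log Dk vanishes at 0, its variation bounds its supremum. Then |Dk − 1| ≤ 2δ, integration
gives |k − id| ≤ 2δ, and exp being 3-Lipschitz on (−∞,1] gives var(Dk) ≤ 3δ; the sum is 7δ. -/
theorem distBV_one_le {k : Homeo} (hk : IsDiffeo 1 k) (h0 : D k 0 = 1) {δ : ℝ} (hδ : 0 ≤ δ)
    (hδ1 : δ ≤ 1) (hvar : eVariationOn (logD k) (Icc 0 1) ≤ ENNReal.ofReal δ) :
    distBV k 1 ≤ ENNReal.ofReal (7 * δ) := by
  have h0m : (0 : ℝ) ∈ Icc (0 : ℝ) 1 := by simp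
  have hL : ∀ x ∈ Icc (0 : ℝ) 1, |logD k x| ≤ δ := fun x hx => by
    have := (eVariationOn.edist_le (logD k) hx h0m).trans hvar
    rwa [(logD_eq_zero_iff hk h0m).2 h0, edist_le_ofReal hδ, Real.dist_0_eq_abs] at this
  have hD : ∀ x ∈ Icc (0 : ℝ) 1, |D k x - 1| ≤ 2 * δ := fun x hx => by
    rw [← exp_logD hk hx]
    exact (Real.abs_exp_sub_one_le ((hL x hx).trans hδ1)).trans (by linarith [hL x hx])
  have hC : ∀ x ∈ Icc (0 : ℝ) 1, |toFun k x - x| ≤ 2 * δ := fun x hx => by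
    have := (convex_Icc (0 : ℝ) 1).norm_image_sub_le_of_norm_hasDerivWithin_le
      (f := fun x => toFun k x - x)
      (fun y hy => (hk.hasDerivWithinAt hy).sub (hasDerivWithinAt_id y _)) (fun y hy => hD y hy)
      h0m hx
    simp only [toFun_zero, sub_zero, Real.norm_eq_abs] at this
    refine this.trans ?_
    rw [abs_of_nonneg hx.1]
    nlinarith [hx.2]
  have hV : eVariationOn (D k) (Icc 0 1) ≤ ENNReal.ofReal (3 * δ) := by
    rw [eVariationOn.congr (g := Real.exp ∘ logD k) fun x hx => (exp_logD hk hx).symm]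
    refine (lipschitzOnWith_exp.comp_eVariationOn_le
      fun x hx => (abs_le.1 (hL x hx)).2.trans hδ1).trans ?_
    rw [ENNReal.ofReal_mul (by norm_num)]
    gcongr
    simp
  unfold distBV
  rw [eVariationOn_D_sub_D_one, show 7 * δ = 2 * δ + 2 * δ + 3 * δ by ring,
    ENNReal.ofReal_add (by positivity) (by positivity),
    ENNReal.ofReal_add (by positivity) (by positivity)]
  gcongr
  · refine iSup₂_le fun x hx => ?_
    rw [toFun_one hx, edist_le_ofReal (by positivity), Real.dist_eq]
    exact hC x hx
  · refine iSup₂_le fun x hx => ?_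
    rw [D_one hx, edist_le_ofReal (by positivity), Real.dist_eq]
    exact hD x hx

theorem HasSmallConjugates.mem_closureBV {f : Homeo} (hf : IsDiffeo 1 f) (h0 : D f 0 = 1)
    (h : HasSmallConjugates f) : 1 ∈ closureBV (conjClassBV f) := by
  refine ⟨isDiffeoBV_one, fun ε hε => ?_⟩
  obtain ⟨r, hr, hr'⟩ := ENNReal.lt_iff_exists_nnreal_btwn.1 hε
  have hr0 : (0 : ℝ) < r := by exact_mod_cast hr
  have hδ : 0 < min 1 ((r : ℝ) / 7) := lt_min one_pos (by positivity)
  obtain ⟨g, hg, hg'⟩ := h (ENNReal.ofReal (min 1 ((r : ℝ) / 7))) (by simpa using hδ)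
  refine ⟨_, ⟨g, hg, rfl⟩, (distBV_one_le (hf.conj hg.1) ?_ hδ.le (min_le_left _ _) hg').trans_lt
    (lt_of_le_of_lt ?_ hr')⟩
  · rw [D_conj_of_fixed hf hg.1 (by simp) (toFun_zero g) (toFun_zero f), h0]
  · rw [← ENNReal.ofReal_coe_nnreal]
    apply ENNReal.ofReal_le_ofReal
    linarith [min_le_right 1 ((r : ℝ) / 7)]

/-! ### Iterates and their distortion. -/

theorem toFun_pow_succ (g : Homeo) (n : ℕ) (x : ℝ) :
    toFun (g ^ (n + 1)) x = toFun (g ^ n) (toFun g x) := by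
  rw [pow_succ, toFun_mul]

theorem toFun_pow_succ' (g : Homeo) (n : ℕ) (x : ℝ) :
    toFun (g ^ (n + 1)) x = toFun g (toFun (g ^ n) x) := by
  rw [pow_succ', toFun_mul]

theorem logD_pow {g : Homeo} (hg : IsDiffeo 1 g) (n : ℕ) {x : ℝ} (hx : x ∈ Icc (0 : ℝ) 1) :
    logD (g ^ n) x = ∑ i ∈ Finset.range n, logD g (toFun (g ^ i) x) := by
  induction n with
  | zero => rw [pow_zero, logD_one hx, Finset.sum_range_zero]
  | succ n ih => rw [pow_succ', logD_mul hg (hg.pow n) hx, ih, Finset.sum_range_succ, add_comm]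

/-- The distortion of the iterates on a fundamental domain is bounded by the variation of the
logarithmic derivative. -/
theorem edist_logD_pow_le {g : Homeo} (hg : IsDiffeo 1 g) (n : ℕ) {p q : ℝ}
    (hp : p ∈ Icc (0 : ℝ) 1) (hq : q ∈ Icc (0 : ℝ) 1) (hpq : p ≤ q) (hqp : q ≤ toFun g p) :
    edist (logD (g ^ n) q) (logD (g ^ n) p) ≤ eVariationOn (logD g) (Icc 0 1) := by
  have hmono : ∀ i, MonotoneOn (toFun (g ^ i)) (Icc 0 1) := fun i =>
    (strictMonoOn_toFun _).monotoneOn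
  have hI : Monotone fun i => toFun (g ^ i) p := monotone_nat_of_le_succ fun i => by
    rw [toFun_pow_succ]
    exact hmono i hp (toFun_mem g p) (hpq.trans hqp)
  have hle : ∀ i, toFun (g ^ i) p ≤ toFun (g ^ (i + 1)) p := fun i => hI i.le_succ
  rw [logD_pow hg n hq, logD_pow hg n hp]
  calc edist (∑ i ∈ Finset.range n, logD g (toFun (g ^ i) q))
        (∑ i ∈ Finset.range n, logD g (toFun (g ^ i) p))
      ≤ ∑ i ∈ Finset.range n, edist (logD g (toFun (g ^ i) q)) (logD g (toFun (g ^ i) p)) := by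
        simp only [edist_eq_enorm_sub, ← Finset.sum_sub_distrib]
        exact enorm_sum_le _ _
    _ ≤ ∑ i ∈ Finset.range n,
          eVariationOn (logD g) (Icc (toFun (g ^ i) p) (toFun (g ^ (i + 1)) p)) := by
        refine Finset.sum_le_sum fun i _ => eVariationOn.edist_le _ ⟨hmono i hp hq hpq, ?_⟩
          (left_mem_Icc.2 (hle i))
        rw [toFun_pow_succ]
        exact hmono i hq (toFun_mem g p) hqp
    -- The images of the fundamental domain [p, g p] are adjacent intervals, so their variations add
    -- up with no overlap.
    _ = eVariationOn (logD g) (Icc (toFun (g ^ 0) p) (toFun (g ^ n) p)) :=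
        eVariationOn.sum' (logD g) hI
    _ ≤ _ := eVariationOn.mono _ (Icc_subset_Icc (toFun_mem _ _).1 (toFun_mem _ _).2)

theorem eq_const_of_add_eq {R : ℝ → ℝ} (h : ∀ t s, 0 ≤ s → s ≤ 1 → R (t + s) = R t) (t : ℝ) :
    R t = R 0 := by
  have hp : Function.Periodic R 1 := fun t => h t 1 zero_le_one le_rfl
  rw [← Int.floor_add_fract t, h _ _ (Int.fract_nonneg t) (Int.fract_lt_one t).le]
  simpa using hp.int_mul_eq ⌊t⌋

namespace IsSzekeres

variable {f : Homeo} {S : Set ℝ} {X : ℝ → ℝ} {φ : ℝ → ℝ → ℝ}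

theorem flow_add_nat (h : IsSzekeres f S X φ) (hS : IsUnitInterval S) {x : ℝ} (hx : x ∈ S)
    (t : ℝ) (n : ℕ) : φ (t + n) x = toFun (f ^ n) (φ t x) := by
  induction n with
  | zero => simp [toFun_one (hS.subset_Icc (h.mapsTo t hx))]
  | succ n ih =>
    rw [Nat.cast_succ, ← add_assoc, h.flow_add_one hS hx, ih, toFun_pow_succ']

theorem logD_pow_eq (h : IsSzekeres f S X φ) (hS : IsUnitInterval S) (hf : MovesRight f)
    (hf1 : IsDiffeo 1 f) {x : ℝ} (hx : x ∈ Ioo (0 : ℝ) 1) (t : ℝ) (n : ℕ) :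
    logD (f ^ n) (φ t x) = Real.log (X (φ (t + n) x)) - Real.log (X (φ t x)) := by
  have hxS := hS.Ioo_subset hx
  induction n with
  | zero => simp [logD_one (hS.subset_Icc (h.mapsTo t hxS))]
  | succ n ih =>
    rw [pow_succ', logD_mul hf1 (hf1.pow n) (hS.subset_Icc (h.mapsTo t hxS)), ih,
      ← h.flow_add_nat hS hxS, h.logD_eq hS hf hf1 hx, Nat.cast_succ, add_assoc]
    ring

end IsSzekeres

/-! ### Necessity: small conjugates force Mather maps to be translations. -/

theorem IsMatherMap.strictMono {f : Homeo} (hf : MovesRight f) {a b : ℝ}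
    (ha : a ∈ Ioo (0 : ℝ) 1) (hb : b ∈ Ioo (0 : ℝ) 1) {M : ℝ → ℝ} (hM : IsMatherMap f a b M) :
    StrictMono M := by
  obtain ⟨X, Y, φ, ψ, hX, hY, hM⟩ := hM
  intro s t hst
  rw [← (hY.strictMono_flow isUnitInterval_Ioc hf hb).lt_iff_lt, hM, hM]
  exact hX.strictMono_flow isUnitInterval_Ico hf ha hst

theorem IsMatherMap.add_one {f : Homeo} (hf : MovesRight f) {a b : ℝ}
    (ha : a ∈ Ioo (0 : ℝ) 1) (hb : b ∈ Ioo (0 : ℝ) 1) {M : ℝ → ℝ} (hM : IsMatherMap f a b M)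
    (t : ℝ) : M (t + 1) = M t + 1 := by
  obtain ⟨X, Y, φ, ψ, hX, hY, hM⟩ := hM
  refine (hY.strictMono_flow isUnitInterval_Ioc hf hb).injective ?_
  rw [hM, hX.flow_add_one isUnitInterval_Ico (Ioo_subset_Ico_self ha),
    hY.flow_add_one isUnitInterval_Ioc (Ioo_subset_Ioc_self hb), hM]

/-- The oscillation of log(X/Y) over a fundamental domain is a lower bound for var(log D) of every
conjugate of f, because it is an asymptotic distortion. It must therefore vanish. -/
theorem exists_eq_add_const_of_movesRight {f : Homeo} (hf1 : IsDiffeo 1 f) (hf : MovesRight f)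
    (h0 : logD f 0 = 0) (h1 : logD f 1 = 0) (hsmall : HasSmallConjugates f) {a b : ℝ}
    (ha : a ∈ Ioo (0 : ℝ) 1) (hb : b ∈ Ioo (0 : ℝ) 1) {M : ℝ → ℝ} (hM : IsMatherMap f a b M) :
    ∃ d, ∀ t, M t = t + d := by
  have hMmono : StrictMono M := hM.strictMono hf ha hb
  have hM1 : ∀ t, M (t + 1) = M t + 1 := hM.add_one hf ha hb
  obtain ⟨X, Y, φ, ψ, hX, hY, hM⟩ := hM
  have hS := isUnitInterval_Ico
  have hT := isUnitInterval_Ioc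
  have haS := hS.Ioo_subset ha
  have hbT := hT.Ioo_subset hb
  have hγ := hX.strictMono_flow hS hf ha
  have hη := hY.strictMono_flow hT hf hb
  set lam : ℝ → ℝ := fun t => Real.log (X (φ t a)) with hlam
  set mu : ℝ → ℝ := fun t => Real.log (Y (ψ t b)) with hmu
  have hlam0 : ∀ s, 0 ≤ s → Tendsto (fun t => lam (t + s) - lam t) atBot (𝓝 0) := fun s hs =>
    tendsto_sub_of_deriv_tendsto_zero (hX.hasDerivAt_log hS hf ha) (Or.inl rfl)
      (hX.tendsto_derivWithin hS hf hf1 ha (Or.inl rfl) (by simp)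
        (hX.tendsto_flow_atBot hS hf ha) h0) hs
  have hmu0 : ∀ s, 0 ≤ s → Tendsto (fun t => mu (t + s) - mu t) atTop (𝓝 0) := fun s hs =>
    tendsto_sub_of_deriv_tendsto_zero (hY.hasDerivAt_log hT hf hb) (Or.inr rfl)
      (hY.tendsto_derivWithin hT hf hf1 hb (Or.inr rfl) (by simp)
        (hY.tendsto_flow_atTop hT hf hb) h1) hs
  -- R(t) is log(X/Y) at the point φ t a.
  set R : ℝ → ℝ := fun t => lam t - mu (M t) with hR
  have hR1 : Function.Periodic R 1 := fun t => by
    have e1 := hX.logD_eq hS hf hf1 ha t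
    have e2 := hY.logD_eq hT hf hf1 hb (M t)
    have e3 : logD f (φ t a) = logD f (ψ (M t) b) := by rw [hM]
    simp only [hR, hlam, hmu, hM1]
    linarith
  have hMsub : ∀ t (k : ℕ), M (t - k) = M t - k := fun t k => by
    induction k with
    | zero => simp
    | succ k ih =>
      have := hM1 (t - (k + 1 : ℕ))
      rw [show t - (k + 1 : ℕ) + 1 = t - k by push_cast; ring, ih] at this
      push_cast at this ⊢
      linarith
  have hto0 : ∀ t : ℝ, Tendsto (fun k : ℕ => t - (k : ℝ)) atTop atBot := fun t =>
    tendsto_atBot_add_const_left _ t (tendsto_neg_atTop_atBot.comp tendsto_natCast_atTop_atTop)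
  have hto1 : ∀ t : ℝ, Tendsto (fun k : ℕ => t + (k : ℝ)) atTop atTop := fun t =>
    tendsto_atTop_add_const_left _ t tendsto_natCast_atTop_atTop
  have hmem : ∀ t, φ t a ∈ Icc (0 : ℝ) 1 := fun t => hS.subset_Icc (hX.mapsTo t haS)
  have hRs : ∀ t s, 0 ≤ s → s ≤ 1 → R (t + s) = R t := by
    intro t s hs hs1
    have hs' : 0 ≤ M (t + s) - M t := sub_nonneg.2 (hMmono.monotone (by linarith))
    have habs : ∀ ε > 0, |R (t + s) - R t| ≤ ε := by
      intro ε hε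
      obtain ⟨h, hh, hvar⟩ := hsmall (ENNReal.ofReal ε) (by simpa using hε)
      set g := h * f * h⁻¹ with hg
      have hg1 : IsDiffeo 1 g := hf1.conj hh.1
      have hlogh0 : ∀ t, Tendsto (fun k : ℕ => logD h (φ (t - k) a)) atTop (𝓝 (logD h 0)) :=
        fun t => (hh.1.continuousOn_logD 0 (by simp)).tendsto.comp (tendsto_nhdsWithin_iff.2
          ⟨(hX.tendsto_flow_atBot hS hf ha).comp (hto0 t), Eventually.of_forall fun k => hmem _⟩)
      have hlogh1 : ∀ t, Tendsto (fun k : ℕ => logD h (φ (t + k) a)) atTop (𝓝 (logD h 1)) :=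
        fun t => (hh.1.continuousOn_logD 1 (by simp)).tendsto.comp (tendsto_nhdsWithin_iff.2
          ⟨(hX.tendsto_flow_atTop hS hf ha).comp (hto1 t), Eventually.of_forall fun k => hmem _⟩)
      -- The error terms: increments of log X near 0 and of log Y near 1, which vanish by
      -- parabolicity, and increments of log Dh, which vanish because log Dh is continuous at 0 and
      -- at 1.
      have hlim : Tendsto (fun k : ℕ => (lam (t - k + s) - lam (t - k))
          - (mu (M t + k + (M (t + s) - M t)) - mu (M t + k))
          + (logD h (φ (t + s - k) a) - logD h (φ (t - k) a))
          - (logD h (φ (t + s + k) a) - logD h (φ (t + k) a))) atTop (𝓝 0) := by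
        have := ((((hlam0 s hs).comp (hto0 t)).sub ((hmu0 _ hs').comp (hto1 (M t)))).add
          ((hlogh0 (t + s)).sub (hlogh0 t))).sub ((hlogh1 (t + s)).sub (hlogh1 t))
        simpa [Function.comp_def] using this
      -- The 2k iterates starting at time u − k cross from near 0 to near 1. Their derivative is
      -- computed twice, through g and then through Y.
      have hlog : ∀ (k : ℕ) u, logD (f ^ (2 * k)) (φ (u - k) a)
          = logD (g ^ (2 * k)) (toFun h (φ (u - k) a)) - logD h (φ (u + k) a)
            + logD h (φ (u - k) a) := fun k u => by
        have e := logD_conj (hf1.pow (2 * k)) hh.1 (hmem (u - k))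
        rw [← conj_pow, ← hX.flow_add_nat hS haS,
          show u - k + ((2 * k : ℕ) : ℝ) = u + k by push_cast; ring] at e
        linarith
      have hmulog : ∀ (k : ℕ) u, logD (f ^ (2 * k)) (φ (u - k) a)
          = mu (M u + k) - mu (M u - k) := fun k u => by
        rw [← hM, hMsub, hY.logD_pow_eq hT hf hf1 hb]
        rw [show M u - k + ((2 * k : ℕ) : ℝ) = M u + k by push_cast; ring]
      have hbound : ∀ k : ℕ, |logD (g ^ (2 * k)) (toFun h (φ (t + s - k) a))
          - logD (g ^ (2 * k)) (toFun h (φ (t - k) a))| ≤ ε := fun k => by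
        have hle : φ (t - k) a ≤ φ (t + s - k) a := hγ.monotone (by linarith)
        have hle' : φ (t + s - k) a ≤ φ (t - k + 1) a := hγ.monotone (by linarith)
        have := (edist_logD_pow_le hg1 (2 * k) (toFun_mem h (φ (t - k) a))
          (toFun_mem h (φ (t + s - k) a))
          ((strictMonoOn_toFun h).monotoneOn (hmem _) (hmem _) hle) (by
            rw [hg, toFun_mul, toFun_inv_toFun h (hmem _), toFun_mul, ← hX.flow_add_one hS haS]
            exact (strictMonoOn_toFun h).monotoneOn (hmem _) (hmem _) hle')).trans hvar
        rwa [edist_le_ofReal hε.le, Real.dist_eq] at this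
      have hlim2 := (hlim.const_sub (R (t + s) - R t)).abs
      rw [sub_zero] at hlim2
      refine le_of_tendsto hlim2 (Eventually.of_forall fun k => ?_)
      -- The increment of R minus the error terms equals, exactly, the distortion of g^(2k) on the
      -- image by h of the fundamental domain.
      refine le_trans (le_of_eq ?_) (hbound k)
      congr 1
      have p1 : ∀ u, R (u - k) = R u := fun u => by simpa using hR1.sub_nat_mul_eq k (x := u)
      have e1 : R (t + s) = lam (t - k + s) - (mu (M (t + s) - k)) := by
        rw [← p1, ← hMsub]; simp only [hR]; rw [show t - k + s = t + s - k by ring]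
      have e2 : R t = lam (t - k) - (mu (M t - k)) := by
        rw [← p1, ← hMsub]
      have e3 := hlog k (t + s)
      have e4 := hlog k t
      rw [hmulog] at e3 e4
      rw [e1, e2, show M t + k + (M (t + s) - M t) = M (t + s) + k by ring]
      linarith
    have : |R (t + s) - R t| ≤ 0 := le_of_forall_pos_le_add fun ε hε => by
      rw [zero_add]; exact habs ε hε
    exact sub_eq_zero.1 (abs_nonpos_iff.1 this)
  have hRc := eq_const_of_add_eq hRs
  set c := R 0
  have hXY : ∀ t, X (φ t a) = Real.exp c * Y (φ t a) := fun t => by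
    have e := hRc t
    simp only [hR, hlam, hmu, hM] at e
    have hYpos : 0 < Y (φ t a) := by rw [← hM]; exact hY.flow_pos hT hf hb _
    rw [← Real.exp_log (hX.flow_pos hS hf ha t), ← Real.exp_log hYpos, ← Real.exp_add, ← e]
    simp
  -- Since X = exp(c)·Y along the orbit, slowing the flow of X by the factor exp(−c) produces an
  -- integral curve of Y.
  have hflow : (fun t => φ (Real.exp (-c) * t) a) = fun t => ψ (M 0 + t) b := by
    refine eq_of_hasDerivAt_vectorField hT.ordConnected hY.contDiffOn (t₀ := 0) (fun t => ?_)
      (fun t => hT.Ioo_subset (hX.flow_mem_Ioo hS ha _))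
      (fun t => (hY.hasDerivAt b hbT (M 0 + t)).comp_const_add (M 0) t)
      (fun t => hY.mapsTo _ hbT) (by simp [hM])
    have := (hX.hasDerivAt a haS (Real.exp (-c) * t)).scomp t
      ((hasDerivAt_id t).const_mul (Real.exp (-c)))
    rw [hXY] at this
    refine HasDerivAt.congr_deriv this ?_
    rw [smul_eq_mul, mul_one, ← mul_assoc, ← Real.exp_add, neg_add_cancel, Real.exp_zero, one_mul]
  have hMeq : ∀ t, M (Real.exp (-c) * t) = M 0 + t := fun t => hη.injective <| by
    simp only [hM]; exact congrFun hflow t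
  -- M is affine of slope exp(c), and M(1) = M(0) + 1 forces that slope to be 1.
  have hc : Real.exp c = 1 := by
    have e1 := hMeq (Real.exp c)
    rw [← Real.exp_add, neg_add_cancel, Real.exp_zero] at e1
    have e2 := hM1 0
    rw [zero_add, e1] at e2
    linarith
  refine ⟨M 0, fun t => ?_⟩
  have := hMeq t
  rw [Real.exp_neg, hc, inv_one, one_mul] at this
  rw [this, add_comm]

/-- The flows generating f⁻¹ are those of f with time reversed. -/
theorem IsMatherMap.inv {f : Homeo} {a b : ℝ} {M : ℝ → ℝ} (h : IsMatherMap f a b M) :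
    IsMatherMap f⁻¹ a b fun t => -M (-t) := by
  obtain ⟨X, Y, φ, ψ, hX, hY, hM⟩ := h
  exact ⟨_, _, _, _, hX.inv isUnitInterval_Ico, hY.inv isUnitInterval_Ioc, fun t => by
    rw [neg_neg, hM]⟩

theorem logD_inv_eq_zero {f : Homeo} (hf : IsDiffeo 1 f) {x : ℝ} (hx : x ∈ Icc (0 : ℝ) 1)
    (hfix : ∀ g : Homeo, toFun g x = x) (h : logD f x = 0) : logD f⁻¹ x = 0 := by
  rw [logD_inv hf hx, hfix, h, neg_zero]

/-- If `f` has conjugates with logarithmic derivative of small variation, then its Mather maps are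
translations. -/
theorem IsMatherMap.exists_eq_add_const {f : Homeo} (hf1 : IsDiffeo 1 f)
    (hf : NoInteriorFixedPoint f) (h0 : logD f 0 = 0) (h1 : logD f 1 = 0)
    (hsmall : HasSmallConjugates f) {a b : ℝ}
    (ha : a ∈ Ioo (0 : ℝ) 1) (hb : b ∈ Ioo (0 : ℝ) 1) {M : ℝ → ℝ} (hM : IsMatherMap f a b M) :
    ∃ d, ∀ t, M t = t + d := by
  rcases hf.movesRight_or with h | h
  · exact exists_eq_add_const_of_movesRight hf1 h h0 h1 hsmall ha hb hM
  · obtain ⟨d, hd⟩ := exists_eq_add_const_of_movesRight hf1.inv h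
      (logD_inv_eq_zero hf1 (by simp) toFun_zero h0)
      (logD_inv_eq_zero hf1 (by simp) toFun_at_one h1)
      (HasSmallConjugates.of_inv hf1.inv (by rwa [inv_inv])) ha hb hM.inv
    refine ⟨-d, fun t => ?_⟩
    have := hd (-t)
    rw [neg_neg] at this
    linarith

/-! ### Sufficiency: conjugators built from prescribed logarithmic derivatives. -/

theorem isDiffeo_one_of_hasDerivWithinAt {h : Homeo} {ρ : ℝ → ℝ} (hρ : ContinuousOn ρ (Icc 0 1))
    (hpos : ∀ x ∈ Icc (0 : ℝ) 1, ρ x ≠ 0)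
    (hd : ∀ x ∈ Icc (0 : ℝ) 1, HasDerivWithinAt (toFun h) (ρ x) (Icc 0 1) x) : IsDiffeo 1 h := by
  have hinv : ∀ y ∈ Icc (0 : ℝ) 1,
      HasDerivWithinAt (toFun h⁻¹) (ρ (toFun h⁻¹ y))⁻¹ (Icc 0 1) y := by
    intro y hy
    have hx := toFun_mem h⁻¹ y
    have h1 : HasFDerivWithinAt (toFun h)
        ((ContinuousLinearEquiv.unitsEquivAut ℝ (Units.mk0 _ (hpos _ hx)) : ℝ ≃L[ℝ] ℝ) : ℝ →L[ℝ] ℝ)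
        (Icc 0 1) (toFun h⁻¹ y) := by
      refine (hd _ hx).hasFDerivWithinAt.congr_fderiv ?_
      ext; simp
    have h2 := h1.of_local_left_inverse (g := toFun h⁻¹) (s := Icc 0 1)
      (tendsto_nhdsWithin_iff.2 ⟨((continuous_toFun h⁻¹).tendsto y).mono_left nhdsWithin_le_nhds,
        Eventually.of_forall fun z => toFun_mem _ z⟩) hy
      (eventually_mem_nhdsWithin.mono fun z hz => toFun_toFun_inv h hz)
    refine h2.hasDerivWithinAt.congr_deriv ?_
    simp
  have key : ∀ {u v : ℝ → ℝ}, ContinuousOn v (Icc 0 1) →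
      (∀ x ∈ Icc (0 : ℝ) 1, HasDerivWithinAt u (v x) (Icc 0 1) x) →
      ContDiffOn ℝ 1 u (Icc 0 1) := fun hv hu =>
    (contDiffOn_one_iff_derivWithin uniqueDiffOn_unit).2
      ⟨fun x hx => (hu x hx).differentiableWithinAt, hv.congr fun x hx =>
        (hu x hx).derivWithin (uniqueDiffOn_unit x hx)⟩
  refine ⟨by exact_mod_cast key hρ hd, ?_⟩
  exact_mod_cast key ((hρ.comp (continuous_toFun h⁻¹).continuousOn fun x _ => toFun_mem _ x).inv₀
    fun x _ => hpos _ (toFun_mem _ x)) hinv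

/-- There is a diffeomorphism with prescribed logarithmic derivative, up to a constant. -/
theorem exists_isDiffeoBV_logD_eq {σ : ℝ → ℝ} {K : NNReal} (hσ : LipschitzOnWith K σ (Icc 0 1)) :
    ∃ h : Homeo, IsDiffeoBV h ∧ ∃ c, ∀ x ∈ Icc (0 : ℝ) 1, logD h x = σ x + c := by
  set ρ : ℝ → ℝ := IccExtend (zero_le_one : (0 : ℝ) ≤ 1) (fun x => Real.exp (σ x)) with hρ
  have hρc : Continuous ρ :=
    (Real.continuous_exp.comp
      (continuousOn_iff_continuous_domRestrict.1 hσ.continuousOn)).Icc_extend'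
  have hρpos : ∀ x, 0 < ρ x := fun x => Real.exp_pos _
  have hρx : ∀ x ∈ Icc (0 : ℝ) 1, ρ x = Real.exp (σ x) := fun x hx => IccExtend_of_mem _ _ hx
  set I := ∫ y in (0 : ℝ)..1, ρ y with hI
  have hIpos : 0 < I := intervalIntegral.intervalIntegral_pos_of_pos
    (hρc.intervalIntegrable _ _) hρpos zero_lt_one
  -- The diffeomorphism is the primitive of exp(σ) normalised to send 1 to 1; the additive constant
  -- in its log derivative is −log I.
  set H : ℝ → ℝ := fun x => (∫ y in (0 : ℝ)..x, ρ y) / I with hH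
  have hder : ∀ x, HasDerivAt H (ρ x / I) x := fun x =>
    (hρc.integral_hasStrictDerivAt 0 x).hasDerivAt.div_const I
  have hHmono : StrictMono H := strictMono_of_hasDerivAt_pos hder fun x => div_pos (hρpos x) hIpos
  have hHc : Continuous H := continuous_iff_continuousAt.2 fun x => (hder x).continuousAt
  have hH0 : H 0 = 0 := by simp [hH]
  have hH1 : H 1 = 1 := div_self hIpos.ne'
  have hmaps : ∀ x : Icc (0 : ℝ) 1, H x ∈ Icc (0 : ℝ) 1 := fun x =>
    ⟨hH0.symm.trans_le (hHmono.monotone x.2.1), (hHmono.monotone x.2.2).trans_eq hH1⟩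
  let e : Icc (0 : ℝ) 1 → Icc (0 : ℝ) 1 := fun x => ⟨H x, hmaps x⟩
  have hemono : StrictMono e := fun x y hxy => hHmono hxy
  have hesurj : Function.Surjective e := fun y => by
    have := intermediate_value_Icc (zero_le_one : (0 : ℝ) ≤ 1) hHc.continuousOn
    rw [hH0, hH1] at this
    obtain ⟨x, hx, hxy⟩ := this y.2
    exact ⟨⟨x, hx⟩, Subtype.ext hxy⟩
  let h : Homeo := hemono.orderIsoOfSurjective e hesurj
  have hh : EqOn (toFun h) H (Icc 0 1) := fun x hx => toFun_of_mem h hx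
  have hhd : ∀ x ∈ Icc (0 : ℝ) 1, HasDerivWithinAt (toFun h) (ρ x / I) (Icc 0 1) x := fun x hx =>
    (hder x).hasDerivWithinAt.congr (fun y hy => hh hy) (hh hx)
  have hdiff : IsDiffeo 1 h := isDiffeo_one_of_hasDerivWithinAt (hρc.div_const I).continuousOn
    (fun x _ => (div_pos (hρpos x) hIpos).ne') hhd
  have hD : ∀ x ∈ Icc (0 : ℝ) 1, D h x = Real.exp (σ x) / I := fun x hx => by
    rw [← hρx x hx]; exact (hhd x hx).derivWithin (uniqueDiffOn_unit x hx)
  refine ⟨h, ⟨hdiff, ?_⟩, -Real.log I, fun x hx => ?_⟩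
  · obtain ⟨m, M, hmM⟩ : ∃ m M, MapsTo σ (Icc 0 1) (Icc m M) := by
      have hne : (Icc (0 : ℝ) 1).Nonempty := ⟨0, by simp⟩
      obtain ⟨p, hp, hp'⟩ := isCompact_Icc.exists_isMinOn hne hσ.continuousOn
      obtain ⟨q, hq, hq'⟩ := isCompact_Icc.exists_isMaxOn hne hσ.continuousOn
      exact ⟨σ p, σ q, fun x hx => ⟨hp' hx, hq' hx⟩⟩
    obtain ⟨K', hK'⟩ := ContDiffOn.exists_lipschitzOnWith_Icc (u := fun y => Real.exp y / I)
      (a := m) (b := M) (Real.contDiff_exp.div_const I).contDiffOn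
    have hvar := hK'.comp_boundedVariationOn hmM
      (hσ.comp_boundedVariationOn (mapsTo_id _) (BoundedVariationOn.id_Icc 0 1))
    unfold BoundedVariationOn at hvar ⊢
    rwa [eVariationOn.congr hD]
  · rw [logD, hD x hx, Real.log_div (Real.exp_pos _).ne' hIpos.ne', Real.log_exp, sub_eq_add_neg]

theorem LipschitzOnWith.eVariationOn_Icc_le {u : ℝ → ℝ} {K : NNReal} {a b : ℝ}
    (hu : LipschitzOnWith K u (Icc a b)) :
    eVariationOn u (Icc a b) ≤ ENNReal.ofReal (K * (b - a)) := by
  have := hu.comp_eVariationOn_le (g := id) (mapsTo_id _)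
  rw [eVariationOn_id_Icc] at this
  rwa [ENNReal.ofReal_mul K.coe_nonneg, ENNReal.ofReal_coe_nnreal]

theorem IsSzekeres.toFun_inv_pow_flow {f : Homeo} {S : Set ℝ} {X : ℝ → ℝ} {φ : ℝ → ℝ → ℝ}
    (h : IsSzekeres f S X φ) (hS : IsUnitInterval S) {x : ℝ} (hx : x ∈ S) (t : ℝ) (n : ℕ) :
    toFun (f⁻¹ ^ n) (φ t x) = φ (t - n) x := by
  have := h.flow_add_nat hS hx (t - n) n
  rw [sub_add_cancel] at this
  rw [this, inv_pow, toFun_inv_toFun _ (hS.subset_Icc (h.mapsTo _ hx))]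

/-- The conjugator spreads f⁻ᵏ on [0,a] and fᵏ on [a,1]. The translation hypothesis enters only
through X = Y, which lets one function log X control both ends of the transition domain. -/
theorem hasSmallConjugates_of_movesRight {f : Homeo} (hf2 : IsDiffeo 2 f) (hf : MovesRight f)
    (h0 : logD f 0 = 0) (h1 : logD f 1 = 0) {a b : ℝ}
    (ha : a ∈ Ioo (0 : ℝ) 1) (hb : b ∈ Ioo (0 : ℝ) 1) {M : ℝ → ℝ} (hM : IsMatherMap f a b M)
    {d : ℝ} (hMd : ∀ t, M t = t + d) : HasSmallConjugates f := by
  obtain ⟨X, Y, φ, ψ, hX, hY, hM⟩ := hM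
  have hf1 : IsDiffeo 1 f := hf2.of_le one_le_two
  have hS := isUnitInterval_Ico
  have hT := isUnitInterval_Ioc
  have haS := hS.Ioo_subset ha
  have hbT := hT.Ioo_subset hb
  have hγ := hX.strictMono_flow hS hf ha
  have hmem : ∀ t, φ t a ∈ Icc (0 : ℝ) 1 := fun t => hS.subset_Icc (hX.mapsTo t haS)
  have hφ0 : φ 0 a = a := hX.map_zero a haS
  set lam : ℝ → ℝ := fun t => Real.log (X (φ t a)) with hlam
  set w : ℝ → ℝ := fun t => derivWithin X (Ico 0 1) (φ t a) with hw
  have hlamd : ∀ t, HasDerivAt lam (w t) t := hX.hasDerivAt_log hS hf ha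
  have hcurve : ∀ t, φ t a = ψ (t + d) b := fun t => by rw [← hM, hMd]
  -- X and Y are both the velocity of the same curve, since the two orbits differ by a time shift.
  have hXY : ∀ t, X (φ t a) = Y (ψ (t + d) b) := fun t => by
    have e1 := (hX.hasDerivAt a haS t).congr_of_eventuallyEq
      (Eventually.of_forall fun t => (hcurve t).symm)
    have e2 := (hY.hasDerivAt b hbT (t + d)).comp_add_const t d
    exact e1.unique e2
  have hw0 : Tendsto w atBot (𝓝 0) := hX.tendsto_derivWithin hS hf hf1 ha (Or.inl rfl) (by simp)
    (hX.tendsto_flow_atBot hS hf ha) h0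
  have hw1 : Tendsto w atTop (𝓝 0) := by
    have e1 := (hY.tendsto_derivWithin hT hf hf1 hb (Or.inr rfl) (by simp)
      (hY.tendsto_flow_atTop hT hf hb) h1).comp (tendsto_atTop_add_const_right atTop d tendsto_id)
    refine e1.congr fun t => ?_
    have e2 := (hY.hasDerivAt_log hT hf hb (t + d)).comp_add_const t d
    simp only [← hXY] at e2
    exact e2.unique (hlamd t)
  obtain ⟨K, hK⟩ := hf2.exists_lipschitzOnWith_logD
  intro ε hε
  obtain ⟨r, hr, hr'⟩ := ENNReal.lt_iff_exists_nnreal_btwn.1 hε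
  have hr0 : (0 : ℝ) < r := by exact_mod_cast hr
  -- The pieces [0, f⁻¹a], [f⁻¹a, a] and [a, 1] contribute δ, 2δ and δ.
  set δ : ℝ := r / 4 with hδ
  have hδ0 : 0 < δ := by positivity
  have hto0 : ∀ t : ℝ, Tendsto (fun k : ℕ => t - (k : ℝ)) atTop atBot := fun t =>
    tendsto_atBot_add_const_left _ t (tendsto_neg_atTop_atBot.comp tendsto_natCast_atTop_atTop)
  have hto1 : ∀ t : ℝ, Tendsto (fun k : ℕ => t + (k : ℝ)) atTop atTop := fun t =>
    tendsto_atTop_add_const_left _ t tendsto_natCast_atTop_atTop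
  have ev1 : ∀ᶠ k : ℕ in atTop, K * φ (-1 - k) a ≤ δ := by
    have := ((hX.tendsto_flow_atBot hS hf ha).comp (hto0 (-1))).const_mul (K : ℝ)
    rw [mul_zero] at this
    exact (this.eventually (gt_mem_nhds hδ0)).mono fun k hk => hk.le
  have ev2 : ∀ᶠ k : ℕ in atTop, K * (1 - φ (0 + k) a) ≤ δ := by
    have := (((hX.tendsto_flow_atTop hS hf ha).comp (hto1 0)).const_sub 1).const_mul (K : ℝ)
    rw [sub_self, mul_zero] at this
    exact (this.eventually (gt_mem_nhds hδ0)).mono fun k hk => hk.le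
  have ev3 : ∀ᶠ k : ℕ in atTop, ∀ s ≤ 0 - (k : ℝ), |w s| ≤ δ := by
    have := hw0.abs
    rw [abs_zero] at this
    obtain ⟨B, hB⟩ := eventually_atBot.1 (this.eventually (gt_mem_nhds hδ0))
    exact ((hto0 0).eventually (eventually_le_atBot B)).mono fun k hk s hs =>
      (hB s (hs.trans hk)).le
  have ev4 : ∀ᶠ k : ℕ in atTop, ∀ s ≥ 0 + (k : ℝ), |w s| ≤ δ := by
    have := hw1.abs
    rw [abs_zero] at this
    obtain ⟨B, hB⟩ := eventually_atTop.1 (this.eventually (gt_mem_nhds hδ0))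
    exact ((hto1 0).eventually (eventually_ge_atTop B)).mono fun k hk s hs =>
      (hB s (le_trans hk hs)).le
  obtain ⟨k, hk1, hk2, hk3, hk4⟩ := (ev1.and (ev2.and (ev3.and ev4))).exists
  set u := logD (f⁻¹ ^ k) with hu
  set v := logD (f ^ k) with hv
  -- Truncating at a glues log Df⁻ᵏ on the left to log Dfᵏ on the right, up to additive constants,
  -- keeping the result Lipschitz.
  set σ : ℝ → ℝ := fun x => u (min x a) + v (max x a) with hσ
  obtain ⟨Ku, hKu⟩ := (hf2.inv.pow k).exists_lipschitzOnWith_logD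
  obtain ⟨Kv, hKv⟩ := (hf2.pow k).exists_lipschitzOnWith_logD
  have hσL := (hKu.comp (LipschitzWith.id.min_const a).lipschitzOnWith (s := Icc 0 1)
    fun x hx => ⟨le_min hx.1 ha.1.le, (min_le_left _ _).trans hx.2⟩).add
    (hKv.comp (LipschitzWith.id.max_const a).lipschitzOnWith (s := Icc 0 1)
    fun x hx => ⟨hx.1.trans (le_max_left _ _), max_le hx.2 ha.2.le⟩)
  obtain ⟨h, hh, c, hc⟩ := exists_isDiffeoBV_logD_eq (σ := σ) hσL
  refine ⟨h, hh, ?_⟩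
  set E : ℝ → ℝ := fun x => σ (toFun f x) + logD f x - σ x with hE
  have hEeq : eVariationOn (logD (h * f * h⁻¹)) (Icc 0 1) = eVariationOn E (Icc 0 1) := by
    rw [← eVariationOn_comp_toFun_unit _ h]
    refine eVariationOn.congr fun x hx => ?_
    simp only [logD_conj hf1 hh.1 hx, hc _ (toFun_mem f x), hc x hx, hE]
    ring
  have hb0 : toFun f (φ (-1) a) = a := by
    rw [← hX.flow_add_one hS haS, neg_add_cancel, hφ0]
  have hfa : φ (-1) a ≤ a := by
    conv_rhs => rw [← hφ0]
    exact hγ.monotone (by norm_num)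
  have haI := Ioo_subset_Icc_self ha
  have hmono := (strictMonoOn_toFun f).monotoneOn
  have hlt : ∀ x ∈ Icc (0 : ℝ) 1, x ≤ toFun f x := fun x hx => by
    rcases hx.1.eq_or_lt with rfl | hx0
    · rw [toFun_zero]
    rcases hx.2.eq_or_lt with rfl | hx1
    · rw [toFun_at_one]
    exact (hf x ⟨hx0, hx1⟩).le
  -- Because f commutes with its iterates, the coboundary of log Df⁻ᵏ turns log Df into log Df
  -- evaluated at the point moved by f⁻ᵏ; `hv'` is the same for fᵏ.
  have hu' : ∀ x ∈ Icc (0 : ℝ) 1,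
      u (toFun f x) + logD f x = logD f (toFun (f⁻¹ ^ k) x) + u x := fun x hx => by
    rw [hu, ← logD_mul (hf1.inv.pow k) hf1 hx, ← logD_mul hf1 (hf1.inv.pow k) hx]
    congr 1
    rw [inv_pow, ← zpow_natCast, ← zpow_neg, ← zpow_add_one, ← zpow_one_add, add_comm]
  have hv' : ∀ x ∈ Icc (0 : ℝ) 1,
      v (toFun f x) + logD f x = logD f (toFun (f ^ k) x) + v x := fun x hx => by
    rw [hv, ← logD_mul (hf1.pow k) hf1 hx, ← logD_mul hf1 (hf1.pow k) hx, ← pow_succ, ← pow_succ']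
  have hE1 : eVariationOn E (Icc 0 (φ (-1) a)) ≤ ENNReal.ofReal δ := by
    rw [eVariationOn.congr (g := fun x => logD f (toFun (f⁻¹ ^ k) x)),
      eVariationOn_comp_toFun _ _ (by simp) (hmem _), toFun_zero, hX.toFun_inv_pow_flow hS haS]
    · refine (LipschitzOnWith.eVariationOn_Icc_le
        (hK.mono (Icc_subset_Icc_right (hmem _).2))).trans ?_
      rw [sub_zero]
      exact ENNReal.ofReal_le_ofReal hk1
    · intro x hx
      have hxI : x ∈ Icc (0 : ℝ) 1 := ⟨hx.1, hx.2.trans (hmem _).2⟩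
      have hfx : toFun f x ≤ a := by rw [← hb0]; exact hmono hxI (hmem _) hx.2
      simp only [hE, hσ, min_eq_left hfx, max_eq_right hfx, min_eq_left (hx.2.trans hfa),
        max_eq_right (hx.2.trans hfa)]
      linarith [hu' x hxI]
  have hE3 : eVariationOn E (Icc a 1) ≤ ENNReal.ofReal δ := by
    rw [eVariationOn.congr (g := fun x => logD f (toFun (f ^ k) x)),
      eVariationOn_comp_toFun _ _ haI (by simp), toFun_at_one]
    · conv_lhs => rw [← hφ0]
      rw [← hX.flow_add_nat hS haS]
      refine (LipschitzOnWith.eVariationOn_Icc_le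
        (hK.mono (Icc_subset_Icc_left (hmem _).1))).trans ?_
      exact ENNReal.ofReal_le_ofReal hk2
    · intro x hx
      have hxI : x ∈ Icc (0 : ℝ) 1 := ⟨ha.1.le.trans hx.1, hx.2⟩
      have hfx : a ≤ toFun f x := hx.1.trans (hlt x hxI)
      simp only [hE, hσ, min_eq_right hfx, max_eq_left hfx, min_eq_right hx.1, max_eq_left hx.1]
      linarith [hv' x hxI]
  have hE2 : eVariationOn E (Icc (φ (-1) a) a) ≤ ENNReal.ofReal (2 * δ) := by
    have himg : (fun t => φ t a) '' Icc (-1) 0 = Icc (φ (-1) a) a := by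
      refine Subset.antisymm ?_ ?_
      · rintro _ ⟨t, ht, rfl⟩
        exact ⟨hγ.monotone ht.1, (hγ.monotone ht.2).trans_eq hφ0⟩
      · have := intermediate_value_Icc (show (-1 : ℝ) ≤ 0 by norm_num)
          (hX.continuous_flow haS).continuousOn
        rwa [hφ0] at this
    rw [← himg, ← eVariationOn.comp_eq_of_monotoneOn E _ (hγ.monotone.monotoneOn _)]
    -- Here x ≤ a ≤ f(x), so the formula for σ switches between x and f(x) and E becomes log Dfᵏ⁺¹ −
    -- log Df⁻ᵏ up to a constant: an increment of log X over time 2k + 1.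
    have hEs : EqOn (E ∘ fun t => φ t a)
        (fun s => lam (s + (k + 1 : ℕ)) - lam (s - k) + (u a - v a)) (Icc (-1) 0) := by
      intro s hs
      have e1 : φ s a ≤ a := (hγ.monotone hs.2).trans_eq hφ0
      have e2 : a ≤ toFun f (φ s a) := by
        rw [← hX.flow_add_one hS haS]
        conv_lhs => rw [← hφ0]
        exact hγ.monotone (by linarith [hs.1])
      have e3 : v (toFun f (φ s a)) + logD f (φ s a) = lam (s + (k + 1 : ℕ)) - lam s := by
        rw [hv, ← logD_mul (hf1.pow k) hf1 (hmem s), ← pow_succ,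
          hX.logD_pow_eq hS hf hf1 ha]
      have e4 : u (φ s a) = lam (s - k) - lam s := by
        rw [hu, inv_pow, logD_inv (hf1.pow k) (hmem s), ← inv_pow, hX.toFun_inv_pow_flow hS haS,
          hX.logD_pow_eq hS hf hf1 ha, sub_add_cancel]
        ring
      simp only [Function.comp_apply, hE, hσ, min_eq_right e2, max_eq_left e2, min_eq_left e1,
        max_eq_right e1]
      linarith
    rw [eVariationOn.congr hEs]
    have hLip : LipschitzOnWith (2 * δ).toNNReal
        (fun s => lam (s + (k + 1 : ℕ)) - lam (s - k) + (u a - v a)) (Icc (-1) 0) := by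
      refine (convex_Icc (-1 : ℝ) 0).lipschitzOnWith_of_nnnorm_hasDerivWithin_le
        (f' := fun s => w (s + (k + 1 : ℕ)) - w (s - k)) (fun s _ => ?_) fun s hs => ?_
      · exact ((((hlamd _).comp_add_const s _).sub ((hlamd _).comp_sub_const s _)).add_const
          _).hasDerivWithinAt
      · rw [← NNReal.coe_le_coe, coe_nnnorm, Real.coe_toNNReal _ (by positivity), Real.norm_eq_abs]
        have e1 := hk4 (s + (k + 1 : ℕ)) (by push_cast; linarith [hs.1])
        have e2 := hk3 (s - k) (by linarith [hs.2])
        exact (abs_sub _ _).trans (by linarith)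
    refine (LipschitzOnWith.eVariationOn_Icc_le hLip).trans (le_of_eq ?_)
    rw [Real.coe_toNNReal _ (by positivity)]
    congr 1; ring
  rw [hEeq, ← univ_inter (Icc (0 : ℝ) 1), ← eVariationOn.Icc_add_Icc E ha.1.le ha.2.le (mem_univ a),
    ← eVariationOn.Icc_add_Icc E (hmem (-1)).1 hfa (mem_univ _)]
  simp only [univ_inter]
  refine ((add_le_add (add_le_add hE1 hE2) hE3).trans (le_of_eq ?_)).trans hr'.le
  rw [← ENNReal.ofReal_add (by positivity) (by positivity),
    ← ENNReal.ofReal_add (by positivity) (by positivity), ← ENNReal.ofReal_coe_nnreal]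
  congr 1
  rw [hδ]; ring

/-- If a Mather map of `f` is a translation and the endpoints are parabolic, then `f` has
conjugates with logarithmic derivative of small variation. -/
theorem IsMatherMap.hasSmallConjugates {f : Homeo} (hf2 : IsDiffeo 2 f)
    (hf : NoInteriorFixedPoint f) (h0 : logD f 0 = 0) (h1 : logD f 1 = 0) {a b : ℝ}
    (ha : a ∈ Ioo (0 : ℝ) 1) (hb : b ∈ Ioo (0 : ℝ) 1) {M : ℝ → ℝ} (hM : IsMatherMap f a b M)
    {d : ℝ} (hMd : ∀ t, M t = t + d) : HasSmallConjugates f := by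
  have hf1 : IsDiffeo 1 f := hf2.of_le one_le_two
  rcases hf.movesRight_or with h | h
  · exact hasSmallConjugates_of_movesRight hf2 h h0 h1 ha hb hM hMd
  · refine HasSmallConjugates.of_inv hf1 (hasSmallConjugates_of_movesRight hf2.inv h
      (logD_inv_eq_zero hf1 (by simp) toFun_zero h0)
      (logD_inv_eq_zero hf1 (by simp) toFun_at_one h1) ha hb hM.inv (d := -d) fun t => ?_)
    rw [hMd]; ring

/-! ### Bounded distortion for maps attracting to 0. -/

/-- `f` moves the points of `(0,1)` to the left. -/
def MovesLeft (f : Homeo) : Prop := ∀ x ∈ Ioo (0 : ℝ) 1, toFun f x < x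

theorem MovesRight.movesLeft {f : Homeo} (hf : MovesRight f⁻¹) : MovesLeft f := fun x hx => by
  have := hf _ (toFun_mem_Ioo f hx)
  rwa [toFun_inv_toFun f (Ioo_subset_Icc_self hx)] at this

theorem MovesRight.inv_movesLeft {f : Homeo} (hf : MovesRight f) : MovesLeft f⁻¹ :=
  MovesRight.movesLeft (by rwa [inv_inv])

namespace MovesLeft

variable {f : Homeo}

theorem iterate_lt (hf : MovesLeft f) {x : ℝ} (hx : x ∈ Ioo (0 : ℝ) 1) (n : ℕ) :
    toFun (f ^ (n + 1)) x < toFun (f ^ n) x := by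
  rw [toFun_pow_succ']
  exact hf _ (toFun_mem_Ioo _ hx)

theorem antitone_iterate (hf : MovesLeft f) {x : ℝ} (hx : x ∈ Ioo (0 : ℝ) 1) :
    Antitone fun n => toFun (f ^ n) x :=
  antitone_nat_of_succ_le fun n => (hf.iterate_lt hx n).le

theorem tendsto_iterate (hf : MovesLeft f) {x : ℝ} (hx : x ∈ Ioo (0 : ℝ) 1) :
    Tendsto (fun n => toFun (f ^ n) x) atTop (𝓝 0) := by
  have hm : ∀ n, toFun (f ^ n) x ∈ Ioo (0 : ℝ) 1 := fun n => toFun_mem_Ioo _ hx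
  have hbdd : BddBelow (range fun n => toFun (f ^ n) x) :=
    ⟨0, by rintro _ ⟨n, rfl⟩; exact (hm n).1.le⟩
  have hlim := tendsto_atTop_ciInf (hf.antitone_iterate hx) hbdd
  set L := ⨅ n, toFun (f ^ n) x
  have h1 : L ≤ toFun (f ^ 0) x := ciInf_le hbdd 0
  have h2 : 0 ≤ L := le_ciInf fun n => (hm n).1.le
  have h3 : toFun f L = L := by
    refine tendsto_nhds_unique (((continuous_toFun f).tendsto L).comp hlim) ?_
    refine (hlim.comp (tendsto_add_atTop_nat 1)).congr fun n => ?_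
    simp only [Function.comp_apply, toFun_pow_succ']
  rcases h2.eq_or_lt with h4 | h4
  · rwa [← h4] at hlim
  · exact absurd h3 (hf L ⟨h4, h1.trans_lt (hm 0).2⟩).ne

theorem hasSum_gap (hf : MovesLeft f) {x : ℝ} (hx : x ∈ Ioo (0 : ℝ) 1) :
    HasSum (fun i => toFun (f ^ i) x - toFun (f ^ (i + 1)) x) x := by
  rw [hasSum_iff_tendsto_nat_of_nonneg fun i => sub_nonneg.2 (hf.iterate_lt hx i).le]
  simp_rw [Finset.sum_range_sub' (fun i => toFun (f ^ i) x)]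
  simpa [toFun_one (Ioo_subset_Icc_self hx)] using (hf.tendsto_iterate hx).const_sub x

/-- Each shifted gap is a sum of m consecutive gaps, so the series is a sum of m tails of the
telescoping one. -/
theorem summable_shift (hf : MovesLeft f) {x : ℝ} (hx : x ∈ Ioo (0 : ℝ) 1) (m : ℕ) :
    Summable fun i => toFun (f ^ i) x - toFun (f ^ (i + m)) x := by
  induction m with
  | zero => simp
  | succ m ih =>
    refine (ih.add ((summable_nat_add_iff m).2 (hf.hasSum_gap hx).summable)).congr fun i => ?_
    rw [show i + (m + 1) = i + m + 1 by ring]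
    ring

theorem abs_logD_iterate_sub_le {K : NNReal} (hK : LipschitzOnWith K (logD f) (Icc 0 1))
    {p q : ℝ} (hp : p ∈ Ioo (0 : ℝ) 1) (hq : q ∈ Ioo (0 : ℝ) 1) (hqp : q ≤ p) {m : ℕ}
    (hpq : toFun (f ^ m) p ≤ q) (i : ℕ) :
    |logD f (toFun (f ^ i) q) - logD f (toFun (f ^ i) p)|
      ≤ K * (toFun (f ^ i) p - toFun (f ^ (i + m)) p) := by
  have hmono := (strictMonoOn_toFun (f ^ i)).monotoneOn
  have hp' := Ioo_subset_Icc_self hp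
  have hq' := Ioo_subset_Icc_self hq
  have h1 : toFun (f ^ (i + m)) p ≤ toFun (f ^ i) q := by
    rw [pow_add, toFun_mul]
    exact hmono (toFun_mem _ _) hq' hpq
  have h2 := hK.dist_le_mul _ (toFun_mem (f ^ i) q) _ (toFun_mem (f ^ i) p)
  rw [Real.dist_eq, Real.dist_eq, abs_sub_comm (toFun (f ^ i) q),
    abs_of_nonneg (sub_nonneg.2 (hmono hq' hp' hqp))] at h2
  exact h2.trans (by gcongr)

/-- The images of [f p, p] have disjoint interiors and total length at most 1, so the Lipschitz
constant of log Df bounds the distortion of all iterates. -/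
theorem abs_logD_pow_sub_le (hf1 : IsDiffeo 1 f) {K : NNReal}
    (hK : LipschitzOnWith K (logD f) (Icc 0 1)) {p q : ℝ} (hp : p ∈ Ioo (0 : ℝ) 1)
    (hq : q ∈ Ioo (0 : ℝ) 1) (hqp : q ≤ p) (hpq : toFun f p ≤ q) (n : ℕ) :
    |logD (f ^ n) q - logD (f ^ n) p| ≤ K := by
  rw [logD_pow hf1 n (Ioo_subset_Icc_self hp), logD_pow hf1 n (Ioo_subset_Icc_self hq),
    ← Finset.sum_sub_distrib]
  calc _ ≤ ∑ i ∈ Finset.range n, |logD f (toFun (f ^ i) q) - logD f (toFun (f ^ i) p)| :=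
        Finset.abs_sum_le_sum_abs _ _
    _ ≤ ∑ i ∈ Finset.range n, K * (toFun (f ^ i) p - toFun (f ^ (i + 1)) p) :=
        Finset.sum_le_sum fun i _ =>
          abs_logD_iterate_sub_le hK hp hq hqp (m := 1) (by rwa [pow_one]) i
    _ = K * (toFun (f ^ 0) p - toFun (f ^ n) p) := by
        rw [← Finset.mul_sum, Finset.sum_range_sub' (fun i => toFun (f ^ i) p)]
    _ ≤ K * 1 := by
        gcongr
        linarith [(toFun_mem (f ^ 0) p).2, (toFun_mem (f ^ n) p).1]
    _ = K := mul_one _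

theorem D_pow_le (hf1 : IsDiffeo 1 f) {K : NNReal}
    (hK : LipschitzOnWith K (logD f) (Icc 0 1)) {p q : ℝ} (hp : p ∈ Ioo (0 : ℝ) 1)
    (hq : q ∈ Ioo (0 : ℝ) 1) (hqp : q ≤ p) (hpq : toFun f p ≤ q) (n : ℕ) :
    D (f ^ n) p ≤ Real.exp K * D (f ^ n) q ∧ D (f ^ n) q ≤ Real.exp K * D (f ^ n) p := by
  have h := abs_le.1 (abs_logD_pow_sub_le hf1 hK hp hq hqp hpq n)
  rw [← exp_logD (hf1.pow n) (Ioo_subset_Icc_self hp),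
    ← exp_logD (hf1.pow n) (Ioo_subset_Icc_self hq), ← Real.exp_add, ← Real.exp_add]
  exact ⟨Real.exp_le_exp.2 (by linarith [h.1]), Real.exp_le_exp.2 (by linarith [h.2])⟩

/-- By the mean value theorem Dfⁿ at some point of the fundamental domain is the n-th gap over the
zeroth one; bounded distortion transfers this to p, and the gaps are summable. -/
theorem summable_D_pow (hf : MovesLeft f) (hf1 : IsDiffeo 1 f) {K : NNReal}
    (hK : LipschitzOnWith K (logD f) (Icc 0 1)) {p : ℝ} (hp : p ∈ Ioo (0 : ℝ) 1) :
    Summable fun n => D (f ^ n) p := by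
  have hpI := Ioo_subset_Icc_self hp
  have hlt := hf p hp
  have hfp := toFun_mem_Ioo f hp
  refine Summable.of_nonneg_of_le (fun n => ((hf1.pow n).D_pos hpI).le) (fun n => ?_)
    (((hf.hasSum_gap hp).summable.div_const (p - toFun f p)).mul_left (Real.exp K))
  obtain ⟨q, hq, hq'⟩ := exists_hasDerivAt_eq_slope (toFun (f ^ n)) (D (f ^ n)) hlt
    (continuous_toFun _).continuousOn
    fun x hx => (hf1.pow n).hasDerivAt ⟨hfp.1.trans hx.1, hx.2.trans hp.2⟩
  have := (D_pow_le hf1 hK hp ⟨hfp.1.trans hq.1, hq.2.trans hp.2⟩ hq.2.le hq.1.le n).1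
  rwa [hq', ← toFun_pow_succ] at this

theorem summable_logD_sub_of_le (hf : MovesLeft f) {K : NNReal}
    (hK : LipschitzOnWith K (logD f) (Icc 0 1)) {p q : ℝ} (hp : p ∈ Ioo (0 : ℝ) 1)
    (hq : q ∈ Ioo (0 : ℝ) 1) (hqp : q ≤ p) :
    Summable fun i => logD f (toFun (f ^ i) q) - logD f (toFun (f ^ i) p) := by
  obtain ⟨m, hm⟩ := ((hf.tendsto_iterate hp).eventually (gt_mem_nhds hq.1)).exists
  exact Summable.of_norm_bounded ((hf.summable_shift hp m).mul_left (K : ℝ)) fun i =>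
    abs_logD_iterate_sub_le hK hp hq hqp hm.le i

theorem summable_logD_sub (hf : MovesLeft f) {K : NNReal}
    (hK : LipschitzOnWith K (logD f) (Icc 0 1)) {p q : ℝ} (hp : p ∈ Ioo (0 : ℝ) 1)
    (hq : q ∈ Ioo (0 : ℝ) 1) :
    Summable fun i => logD f (toFun (f ^ i) q) - logD f (toFun (f ^ i) p) := by
  rcases le_total q p with h | h
  · exact hf.summable_logD_sub_of_le hK hp hq h
  · exact (hf.summable_logD_sub_of_le hK hq hp h).neg.congr fun i => neg_sub _ _

end MovesLeft

/-! ### The limit of normalised logarithmic derivatives of iterates. -/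

/-- The limit of `log Dfⁿ(x) - log Dfⁿ(a)`. -/
noncomputable def logDLimit (f : Homeo) (a x : ℝ) : ℝ :=
  ∑' i : ℕ, (logD f (toFun (f ^ i) x) - logD f (toFun (f ^ i) a))

/-- The derivative of `logDLimit f a`. -/
noncomputable def logDLimitDeriv (f : Homeo) (x : ℝ) : ℝ :=
  ∑' i : ℕ, deriv (logD f) (toFun (f ^ i) x) * D (f ^ i) x

namespace MovesLeft

variable {f : Homeo} {K : NNReal} {a : ℝ}

theorem tendsto_logD_pow_sub (hf : MovesLeft f) (hf1 : IsDiffeo 1 f)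
    (hK : LipschitzOnWith K (logD f) (Icc 0 1)) {p q : ℝ} (hp : p ∈ Ioo (0 : ℝ) 1)
    (hq : q ∈ Ioo (0 : ℝ) 1) (ha : a ∈ Ioo (0 : ℝ) 1) :
    Tendsto (fun n => logD (f ^ n) q - logD (f ^ n) p) atTop
      (𝓝 (logDLimit f a q - logDLimit f a p)) := by
  have h := (hf.summable_logD_sub hK ha hq).hasSum.tendsto_sum_nat.sub
    (hf.summable_logD_sub hK ha hp).hasSum.tendsto_sum_nat
  refine h.congr fun n => ?_
  rw [logD_pow hf1 n (Ioo_subset_Icc_self hp), logD_pow hf1 n (Ioo_subset_Icc_self hq),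
    Finset.sum_sub_distrib, Finset.sum_sub_distrib]
  ring

theorem abs_logDLimit_sub_le (hf : MovesLeft f) (hf1 : IsDiffeo 1 f)
    (hK : LipschitzOnWith K (logD f) (Icc 0 1)) (ha : a ∈ Ioo (0 : ℝ) 1) {p q : ℝ}
    (hp : p ∈ Ioo (0 : ℝ) 1) (hq : q ∈ Ioo (0 : ℝ) 1) (hqp : q ≤ p) (hpq : toFun f p ≤ q) :
    |logDLimit f a q - logDLimit f a p| ≤ K :=
  le_of_tendsto (hf.tendsto_logD_pow_sub hf1 hK hp hq ha).abs
    (Eventually.of_forall fun n => abs_logD_pow_sub_le hf1 hK hp hq hqp hpq n)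

/-- Expanding log Dfⁿ⁺¹(x) in two ways leaves the boundary term log Df(fⁿx), which tends to log
Df(0) = 0. This identity makes exp(−`logDLimit f a`) a field preserved by f. -/
theorem logDLimit_apply (hf : MovesLeft f) (hf1 : IsDiffeo 1 f)
    (hK : LipschitzOnWith K (logD f) (Icc 0 1)) (h0 : logD f 0 = 0) (ha : a ∈ Ioo (0 : ℝ) 1)
    {x : ℝ} (hx : x ∈ Ioo (0 : ℝ) 1) :
    logDLimit f a (toFun f x) = logDLimit f a x - logD f x := by
  have h1 := hf.tendsto_logD_pow_sub hf1 hK hx (toFun_mem_Ioo f hx) ha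
  have h2 : Tendsto (fun n => logD f (toFun (f ^ n) x)) atTop (𝓝 (logD f 0)) :=
    (hf1.continuousOn_logD 0 (by simp)).tendsto.comp (tendsto_nhdsWithin_iff.2
      ⟨hf.tendsto_iterate hx, Eventually.of_forall fun n => toFun_mem _ _⟩)
  have hxI := Ioo_subset_Icc_self hx
  have h3 : (fun n => logD (f ^ n) (toFun f x) - logD (f ^ n) x)
      = fun n => logD f (toFun (f ^ n) x) - logD f x := by
    ext n
    have e1 := logD_mul (hf1.pow n) hf1 hxI
    have e2 := logD_mul hf1 (hf1.pow n) hxI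
    rw [← pow_succ] at e1
    rw [← pow_succ'] at e2
    linarith
  rw [h3] at h1
  have := tendsto_nhds_unique h1 (h2.sub_const (logD f x))
  rw [h0] at this
  linarith

theorem logDLimit_iterate (hf : MovesLeft f) (hf1 : IsDiffeo 1 f)
    (hK : LipschitzOnWith K (logD f) (Icc 0 1)) (h0 : logD f 0 = 0) (ha : a ∈ Ioo (0 : ℝ) 1)
    {x : ℝ} (hx : x ∈ Ioo (0 : ℝ) 1) (n : ℕ) :
    logDLimit f a (toFun (f ^ n) x) = logDLimit f a x - logD (f ^ n) x := by
  have hxI := Ioo_subset_Icc_self hx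
  induction n with
  | zero => rw [pow_zero, toFun_one hxI, logD_one hxI, sub_zero]
  | succ n ih =>
    rw [toFun_pow_succ', hf.logDLimit_apply hf1 hK h0 ha (toFun_mem_Ioo _ hx), ih, pow_succ',
      logD_mul hf1 (hf1.pow n) hxI]
    ring

theorem hasDerivAt_logD (hf2 : IsDiffeo 2 f) {x : ℝ} (hx : x ∈ Ioo (0 : ℝ) 1) :
    HasDerivAt (logD f) (deriv (logD f) x) x :=
  ((hf2.contDiffOn_logD.differentiableOn (by norm_num)).differentiableAt
    (Icc_mem_nhds hx.1 hx.2)).hasDerivAt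

theorem continuousOn_deriv_logD (hf2 : IsDiffeo 2 f) :
    ContinuousOn (deriv (logD f)) (Ioo 0 1) :=
  (hf2.contDiffOn_logD.mono Ioo_subset_Icc_self).continuousOn_deriv_of_isOpen isOpen_Ioo
    (by norm_num)

theorem abs_deriv_logD_le (hK : LipschitzOnWith K (logD f) (Icc 0 1)) {x : ℝ}
    (hx : x ∈ Ioo (0 : ℝ) 1) : |deriv (logD f) x| ≤ K :=
  norm_deriv_le_of_lipschitzOn (Icc_mem_nhds hx.1 hx.2) hK

/-- Local uniform bounds for the terms of the series defining `logDLimitDeriv`. -/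
theorem exists_bound (hf : MovesLeft f) (hf1 : IsDiffeo 1 f)
    (hK : LipschitzOnWith K (logD f) (Icc 0 1)) {x : ℝ} (hx : x ∈ Ioo (0 : ℝ) 1) :
    ∃ c ∈ Ioo (0 : ℝ) 1, x ∈ Ioo (toFun f c) c ∧ Ioo (toFun f c) c ⊆ Ioo 0 1 ∧
      ∃ u : ℕ → ℝ, Summable u ∧ ∀ i, ∀ y ∈ Ioo (toFun f c) c,
        ‖deriv (logD f) (toFun (f ^ i) y) * D (f ^ i) y‖ ≤ u i := by
  have hx' := toFun_mem_Ioo f⁻¹ hx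
  have hxx : x < toFun f⁻¹ x := by
    have := hf _ hx'
    rwa [toFun_toFun_inv f (Ioo_subset_Icc_self hx)] at this
  -- With c strictly between x and f⁻¹x, the point x is interior to the fundamental domain of c,
  -- where Dfⁱ is comparable to Dfⁱ(c).
  obtain ⟨c, hc1, hc2⟩ := exists_between hxx
  have hc : c ∈ Ioo (0 : ℝ) 1 := ⟨hx.1.trans hc1, hc2.trans hx'.2⟩
  have hfc : toFun f c < x := by
    have := strictMonoOn_toFun f (Ioo_subset_Icc_self hc) (Ioo_subset_Icc_self hx') hc2
    rwa [toFun_toFun_inv f (Ioo_subset_Icc_self hx)] at this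
  have hsub : Ioo (toFun f c) c ⊆ Ioo 0 1 := fun y hy =>
    ⟨(toFun_mem_Ioo f hc).1.trans hy.1, hy.2.trans hc.2⟩
  refine ⟨c, hc, ⟨hfc, hc1⟩, hsub, fun i => K * (Real.exp K * D (f ^ i) c),
    ((hf.summable_D_pow hf1 hK hc).mul_left _).mul_left _, fun i y hy => ?_⟩
  have hpos := (hf1.pow i).D_pos (Ioo_subset_Icc_self (hsub hy))
  rw [norm_mul, Real.norm_eq_abs, Real.norm_eq_abs, abs_of_pos hpos]
  have h1 := abs_deriv_logD_le hK (toFun_mem_Ioo (f ^ i) (hsub hy))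
  have h2 := (D_pow_le hf1 hK hc (hsub hy) hy.2.le hy.1.le i).2
  exact mul_le_mul h1 h2 hpos.le K.coe_nonneg

theorem hasDerivAt_logDLimit (hf : MovesLeft f) (hf2 : IsDiffeo 2 f)
    (hK : LipschitzOnWith K (logD f) (Icc 0 1)) (ha : a ∈ Ioo (0 : ℝ) 1) {x : ℝ}
    (hx : x ∈ Ioo (0 : ℝ) 1) : HasDerivAt (logDLimit f a) (logDLimitDeriv f x) x := by
  have hf1 : IsDiffeo 1 f := hf2.of_le one_le_two
  obtain ⟨c, hc, hxc, hsub, u, hu, hbound⟩ := hf.exists_bound hf1 hK hx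
  refine hasDerivAt_tsum_of_isPreconnected hu isOpen_Ioo isPreconnected_Ioo (fun i y hy => ?_)
    hbound hxc (hf.summable_logD_sub hK ha hx) hxc
  exact ((hasDerivAt_logD hf2 (toFun_mem_Ioo (f ^ i) (hsub hy))).comp y
    ((hf1.pow i).hasDerivAt (hsub hy))).sub_const _

theorem continuousAt_logDLimitDeriv (hf : MovesLeft f) (hf2 : IsDiffeo 2 f)
    (hK : LipschitzOnWith K (logD f) (Icc 0 1)) {x : ℝ} (hx : x ∈ Ioo (0 : ℝ) 1) :
    ContinuousAt (logDLimitDeriv f) x := by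
  have hf1 : IsDiffeo 1 f := hf2.of_le one_le_two
  obtain ⟨c, hc, hxc, hsub, u, hu, hbound⟩ := hf.exists_bound hf1 hK hx
  refine (continuousOn_tsum (fun i => ?_) hu hbound).continuousAt (Ioo_mem_nhds hxc.1 hxc.2)
  exact ((continuousOn_deriv_logD hf2).comp (continuous_toFun _).continuousOn
    fun y hy => toFun_mem_Ioo _ (hsub hy)).mul
    ((hf1.pow i).continuousOn_D.mono (hsub.trans Ioo_subset_Icc_self))

end MovesLeft

/-! ### Construction of the Szekeres vector field. -/

/-- A time coordinate for the vector field proportional to `exp (-logDLimit f a)`. -/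
noncomputable def timeCoord (f : Homeo) (a x : ℝ) : ℝ :=
  ∫ y in a..x, Real.exp (logDLimit f a y)

/-- The increment of `timeCoord` on fundamental domains. -/
noncomputable def timeStep (f : Homeo) (a : ℝ) : ℝ := -timeCoord f a (toFun f a)

open Classical in
/-- Szekeres' vector field of `f` on `[0,1)`, when `f` moves points to the left. -/
noncomputable def szekeresField (f : Homeo) (a x : ℝ) : ℝ :=
  if x ∈ Ioo (0 : ℝ) 1 then -(timeStep f a * Real.exp (-logDLimit f a x)) else 0

open Classical in
/-- The derivative of `szekeresField`. -/
noncomputable def szekeresFieldDeriv (f : Homeo) (a x : ℝ) : ℝ :=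
  if x ∈ Ioo (0 : ℝ) 1 then
    timeStep f a * Real.exp (-logDLimit f a x) * logDLimitDeriv f x else 0

namespace MovesLeft

variable {f : Homeo} {K : NNReal} {a : ℝ}

theorem continuousOn_exp_logDLimit (hf : MovesLeft f) (hf2 : IsDiffeo 2 f)
    (hK : LipschitzOnWith K (logD f) (Icc 0 1)) (ha : a ∈ Ioo (0 : ℝ) 1) :
    ContinuousOn (fun x => Real.exp (logDLimit f a x)) (Ioo 0 1) := fun _ hx =>
  (hf.hasDerivAt_logDLimit hf2 hK ha hx).continuousAt.rexp.continuousWithinAt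

theorem hasDerivAt_timeCoord (hf : MovesLeft f) (hf2 : IsDiffeo 2 f)
    (hK : LipschitzOnWith K (logD f) (Icc 0 1)) (ha : a ∈ Ioo (0 : ℝ) 1) {x : ℝ}
    (hx : x ∈ Ioo (0 : ℝ) 1) :
    HasDerivAt (timeCoord f a) (Real.exp (logDLimit f a x)) x := by
  have hc := hf.continuousOn_exp_logDLimit hf2 hK ha
  refine intervalIntegral.integral_hasDerivAt_right
    (hc.mono (ordConnected_Ioo.uIcc_subset ha hx)).intervalIntegrable
    (hc.stronglyMeasurableAtFilter isOpen_Ioo x hx) (hc.continuousAt (Ioo_mem_nhds hx.1 hx.2))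

theorem strictMonoOn_timeCoord (hf : MovesLeft f) (hf2 : IsDiffeo 2 f)
    (hK : LipschitzOnWith K (logD f) (Icc 0 1)) (ha : a ∈ Ioo (0 : ℝ) 1) :
    StrictMonoOn (timeCoord f a) (Ioo 0 1) := by
  refine strictMonoOn_of_deriv_pos (convex_Ioo 0 1) (fun x hx =>
    (hf.hasDerivAt_timeCoord hf2 hK ha hx).continuousAt.continuousWithinAt) fun x hx => ?_
  rw [interior_Ioo] at hx
  rw [(hf.hasDerivAt_timeCoord hf2 hK ha hx).deriv]
  exact Real.exp_pos _

/-- The functional equation of `logDLimit` says that T∘f and T have the same derivative, so f acts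
as a translation in the coordinate T. -/
theorem timeCoord_apply (hf : MovesLeft f) (hf2 : IsDiffeo 2 f)
    (hK : LipschitzOnWith K (logD f) (Icc 0 1)) (h0 : logD f 0 = 0) (ha : a ∈ Ioo (0 : ℝ) 1)
    {x : ℝ} (hx : x ∈ Ioo (0 : ℝ) 1) :
    timeCoord f a (toFun f x) = timeCoord f a x - timeStep f a := by
  have hf1 : IsDiffeo 1 f := hf2.of_le one_le_two
  have hd : ∀ y ∈ Ioo (0 : ℝ) 1,
      HasDerivAt (fun y => timeCoord f a (toFun f y) - timeCoord f a y) 0 y := fun y hy => by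
    refine (((hf.hasDerivAt_timeCoord hf2 hK ha (toFun_mem_Ioo f hy)).comp y
      (hf1.hasDerivAt hy)).sub (hf.hasDerivAt_timeCoord hf2 hK ha hy)).congr_deriv ?_
    rw [hf.logDLimit_apply hf1 hK h0 ha hy, ← exp_logD hf1 (Ioo_subset_Icc_self hy),
      ← Real.exp_add, sub_add_cancel, sub_self]
  have := isOpen_Ioo.is_const_of_deriv_eq_zero isPreconnected_Ioo
    (fun y hy => (hd y hy).differentiableAt.differentiableWithinAt) (fun y hy => (hd y hy).deriv)
    hx ha
  have haa : timeCoord f a a = 0 := intervalIntegral.integral_same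
  simp only [haa] at this
  rw [timeStep]
  linarith

theorem timeStep_pos (hf : MovesLeft f) (hf2 : IsDiffeo 2 f)
    (hK : LipschitzOnWith K (logD f) (Icc 0 1)) (h0 : logD f 0 = 0) (ha : a ∈ Ioo (0 : ℝ) 1) :
    0 < timeStep f a := by
  have h1 := hf.timeCoord_apply hf2 hK h0 ha ha
  have h2 := hf.strictMonoOn_timeCoord hf2 hK ha (toFun_mem_Ioo f ha) ha (hf a ha)
  linarith

theorem timeCoord_iterate (hf : MovesLeft f) (hf2 : IsDiffeo 2 f)
    (hK : LipschitzOnWith K (logD f) (Icc 0 1)) (h0 : logD f 0 = 0) (ha : a ∈ Ioo (0 : ℝ) 1)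
    {x : ℝ} (hx : x ∈ Ioo (0 : ℝ) 1) (n : ℕ) :
    timeCoord f a (toFun (f ^ n) x) = timeCoord f a x - n * timeStep f a := by
  induction n with
  | zero => simp [toFun_one (Ioo_subset_Icc_self hx)]
  | succ n ih =>
    rw [toFun_pow_succ', hf.timeCoord_apply hf2 hK h0 ha (toFun_mem_Ioo _ hx), ih]
    push_cast; ring

theorem surjOn_timeCoord (hf : MovesLeft f) (hf2 : IsDiffeo 2 f)
    (hK : LipschitzOnWith K (logD f) (Icc 0 1)) (h0 : logD f 0 = 0) (ha : a ∈ Ioo (0 : ℝ) 1)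
    (s : ℝ) : ∃ x ∈ Ioo (0 : ℝ) 1, timeCoord f a x = s := by
  have hA := hf.timeStep_pos hf2 hK h0 ha
  obtain ⟨n, hn⟩ := exists_nat_gt (|s| / timeStep f a)
  rw [div_lt_iff₀ hA] at hn
  have haa : timeCoord f a a = 0 := intervalIntegral.integral_same
  have h1 := hf.timeCoord_iterate hf2 hK h0 ha ha n
  have hmem := toFun_mem_Ioo (f ^ n)⁻¹ ha
  have h2 := hf.timeCoord_iterate hf2 hK h0 ha hmem n
  rw [toFun_toFun_inv _ (Ioo_subset_Icc_self ha), haa] at h2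
  rw [haa] at h1
  have hs := abs_le.1 hn.le
  obtain ⟨x, hx, hx'⟩ := isPreconnected_Ioo.intermediate_value (toFun_mem_Ioo (f ^ n) ha) hmem
    (fun x hx => (hf.hasDerivAt_timeCoord hf2 hK ha hx).continuousAt.continuousWithinAt)
    (show s ∈ Icc _ _ from ⟨by linarith [hs.1], by linarith [hs.2]⟩)
  exact ⟨x, hx, hx'⟩

/-- The step is the integral of exp(`logDLimit`) over [f x, x], hence x − f(x) times a value of the
integrand, which is within a factor exp(K) of its value at x. -/
theorem timeStep_mul_exp_le (hf : MovesLeft f) (hf2 : IsDiffeo 2 f)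
    (hK : LipschitzOnWith K (logD f) (Icc 0 1)) (h0 : logD f 0 = 0) (ha : a ∈ Ioo (0 : ℝ) 1)
    {x : ℝ} (hx : x ∈ Ioo (0 : ℝ) 1) :
    timeStep f a * Real.exp (-logDLimit f a x) ≤ Real.exp K * (x - toFun f x) := by
  have hf1 : IsDiffeo 1 f := hf2.of_le one_le_two
  have hfx := toFun_mem_Ioo f hx
  have hsub : Icc (toFun f x) x ⊆ Ioo 0 1 := Icc_subset_Ioo hfx.1 hx.2
  obtain ⟨z, hz, hz'⟩ := exists_hasDerivAt_eq_slope (timeCoord f a)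
    (fun x => Real.exp (logDLimit f a x)) (hf x hx)
    (fun y hy => (hf.hasDerivAt_timeCoord hf2 hK ha (hsub hy)).continuousAt.continuousWithinAt)
    fun y hy => hf.hasDerivAt_timeCoord hf2 hK ha (hsub (Ioo_subset_Icc_self hy))
  have hpos : 0 < x - toFun f x := sub_pos.2 (hf x hx)
  rw [hf.timeCoord_apply hf2 hK h0 ha hx, sub_sub_cancel, eq_div_iff hpos.ne'] at hz'
  have h1 := (abs_le.1 (hf.abs_logDLimit_sub_le hf1 hK ha hx (hsub (Ioo_subset_Icc_self hz))
    hz.2.le hz.1.le)).2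
  rw [← hz', mul_right_comm, ← Real.exp_add]
  gcongr
  linarith

theorem abs_szekeresField_le (hf : MovesLeft f) (hf2 : IsDiffeo 2 f)
    (hK : LipschitzOnWith K (logD f) (Icc 0 1)) (h0 : logD f 0 = 0) (ha : a ∈ Ioo (0 : ℝ) 1)
    (x : ℝ) : |szekeresField f a x| ≤ Real.exp K * |x - toFun f x| := by
  unfold szekeresField
  split_ifs with h
  · rw [abs_neg, abs_of_pos (mul_pos (hf.timeStep_pos hf2 hK h0 ha) (Real.exp_pos _)),
      abs_of_pos (sub_pos.2 (hf x h))]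
    exact hf.timeStep_mul_exp_le hf2 hK h0 ha h
  · rw [abs_zero]; positivity

/-- Invariance turns |X(x)|·Dfⁱ(x) into |X(fⁱx)|, which is at most exp(K) times the i-th gap. The
gaps sum to x, so the derivative tends to 0 at 0: this is the C¹ regularity at the endpoint. -/
theorem abs_szekeresFieldDeriv_le (hf : MovesLeft f) (hf2 : IsDiffeo 2 f)
    (hK : LipschitzOnWith K (logD f) (Icc 0 1)) (h0 : logD f 0 = 0) (ha : a ∈ Ioo (0 : ℝ) 1)
    {x : ℝ} (hx : 0 ≤ x) : |szekeresFieldDeriv f a x| ≤ K * (Real.exp K * x) := by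
  have hf1 : IsDiffeo 1 f := hf2.of_le one_le_two
  unfold szekeresFieldDeriv
  split_ifs with h
  · have hxI := Ioo_subset_Icc_self h
    have hA := hf.timeStep_pos hf2 hK h0 ha
    rw [logDLimitDeriv, ← tsum_mul_left, ← Real.norm_eq_abs]
    refine tsum_of_norm_bounded (((hf.hasSum_gap h).mul_left (Real.exp K)).mul_left (K : ℝ))
      fun i => ?_
    have hi := toFun_mem_Ioo (f ^ i) h
    have e1 : timeStep f a * Real.exp (-logDLimit f a (toFun (f ^ i) x))
        = timeStep f a * Real.exp (-logDLimit f a x) * D (f ^ i) x := by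
      rw [hf.logDLimit_iterate hf1 hK h0 ha h, ← exp_logD (hf1.pow i) hxI, mul_assoc,
        ← Real.exp_add]
      congr 2; ring
    have e2 := hf.timeStep_mul_exp_le hf2 hK h0 ha hi
    rw [← toFun_pow_succ'] at e2
    rw [mul_left_comm, ← e1, norm_mul, Real.norm_eq_abs, Real.norm_eq_abs,
      abs_of_pos (mul_pos hA (Real.exp_pos _))]
    exact mul_le_mul (abs_deriv_logD_le hK hi) e2 (mul_pos hA (Real.exp_pos _)).le K.coe_nonneg
  · rw [abs_zero]; positivity

theorem hasDerivAt_szekeresField (hf : MovesLeft f) (hf2 : IsDiffeo 2 f)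
    (hK : LipschitzOnWith K (logD f) (Icc 0 1)) (ha : a ∈ Ioo (0 : ℝ) 1)
    {x : ℝ} (hx : x ∈ Ioo (0 : ℝ) 1) :
    HasDerivAt (szekeresField f a) (szekeresFieldDeriv f a x) x := by
  have h1 := ((hf.hasDerivAt_logDLimit hf2 hK ha hx).neg.exp.const_mul (timeStep f a)).neg
  refine (h1.congr_of_eventuallyEq ?_).congr_deriv ?_
  · filter_upwards [Ioo_mem_nhds hx.1 hx.2] with y hy
    exact if_pos hy
  · simp only [szekeresFieldDeriv, if_pos hx, Pi.neg_apply]; ring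

/-- X is bounded by a constant times |x − f(x)|, which is o(x) because Df(0) = 1. -/
theorem hasDerivWithinAt_szekeresField_zero (hf : MovesLeft f) (hf2 : IsDiffeo 2 f)
    (hK : LipschitzOnWith K (logD f) (Icc 0 1)) (h0 : logD f 0 = 0) (ha : a ∈ Ioo (0 : ℝ) 1) :
    HasDerivWithinAt (szekeresField f a) 0 (Ico 0 1) 0 := by
  have hf1 : IsDiffeo 1 f := hf2.of_le one_le_two
  have hD : D f 0 = 1 := (logD_eq_zero_iff hf1 (by simp)).1 h0
  have h1 : HasDerivWithinAt (fun x => x - toFun f x) 0 (Icc 0 1) 0 := by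
    refine ((hasDerivWithinAt_id 0 _).sub (hf1.hasDerivWithinAt (by simp))).congr_deriv ?_
    rw [hD, sub_self]
  have h2 := hasDerivWithinAt_iff_isLittleO.1 (h1.mono Ico_subset_Icc_self)
  rw [hasDerivWithinAt_iff_isLittleO]
  have hX0 : szekeresField f a 0 = 0 := by simp [szekeresField]
  simp only [toFun_zero, sub_zero, smul_zero, hX0] at h2 ⊢
  refine Asymptotics.IsBigO.trans_isLittleO (Asymptotics.IsBigO.of_bound (Real.exp K) ?_) h2
  filter_upwards with x
  exact hf.abs_szekeresField_le hf2 hK h0 ha x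

theorem contDiffOn_szekeresField (hf : MovesLeft f) (hf2 : IsDiffeo 2 f)
    (hK : LipschitzOnWith K (logD f) (Icc 0 1)) (h0 : logD f 0 = 0) (ha : a ∈ Ioo (0 : ℝ) 1) :
    ContDiffOn ℝ 1 (szekeresField f a) (Ico 0 1) := by
  have hder : ∀ x ∈ Ico (0 : ℝ) 1,
      HasDerivWithinAt (szekeresField f a) (szekeresFieldDeriv f a x) (Ico 0 1) x := by
    intro x hx
    rcases hx.1.eq_or_lt with rfl | h
    · have : szekeresFieldDeriv f a 0 = 0 := by simp [szekeresFieldDeriv]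
      rw [this]
      exact hf.hasDerivWithinAt_szekeresField_zero hf2 hK h0 ha
    · exact (hf.hasDerivAt_szekeresField hf2 hK ha ⟨h, hx.2⟩).hasDerivWithinAt
  have huniq : UniqueDiffOn ℝ (Ico (0 : ℝ) 1) := uniqueDiffOn_Ico 0 1
  refine (contDiffOn_one_iff_derivWithin huniq).2
    ⟨fun x hx => (hder x hx).differentiableWithinAt,
      ContinuousOn.congr (f := szekeresFieldDeriv f a)
      (fun x hx => ?_) fun x hx => (hder x hx).derivWithin (huniq x hx)⟩
  rcases hx.1.eq_or_lt with rfl | h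
  · have hz : szekeresFieldDeriv f a 0 = 0 := by simp [szekeresFieldDeriv]
    rw [ContinuousWithinAt, hz]
    refine squeeze_zero_norm' (a := fun x => K * (Real.exp K * x)) ?_ ?_
    · filter_upwards [self_mem_nhdsWithin] with y hy
      exact hf.abs_szekeresFieldDeriv_le hf2 hK h0 ha hy.1
    · have : Continuous fun x : ℝ => (K : ℝ) * (Real.exp K * x) := by fun_prop
      simpa using (this.tendsto 0).mono_left nhdsWithin_le_nhds
  · have hxx : x ∈ Ioo (0 : ℝ) 1 := ⟨h, hx.2⟩
    refine ContinuousAt.continuousWithinAt (ContinuousAt.congr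
      (f := fun x => timeStep f a * Real.exp (-logDLimit f a x) * logDLimitDeriv f x) ?_ ?_)
    · exact (continuousAt_const.mul
        (hf.hasDerivAt_logDLimit hf2 hK ha hxx).continuousAt.neg.rexp).mul
        (hf.continuousAt_logDLimitDeriv hf2 hK hxx)
    · filter_upwards [Ioo_mem_nhds hxx.1 hxx.2] with y hy
      exact (if_pos hy).symm

theorem continuousOn_szekeresField (hf : MovesLeft f) (hf2 : IsDiffeo 2 f)
    (hK : LipschitzOnWith K (logD f) (Icc 0 1)) (h0 : logD f 0 = 0) (ha : a ∈ Ioo (0 : ℝ) 1) :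
    ContinuousOn (szekeresField f a) (Icc 0 1) := by
  intro x hx
  rcases hx.2.eq_or_lt with rfl | h
  · have hz : szekeresField f a 1 = 0 := by simp [szekeresField]
    rw [ContinuousWithinAt, hz]
    refine squeeze_zero_norm' (a := fun x => Real.exp K * |x - toFun f x|) ?_ ?_
    · filter_upwards with y
      exact hf.abs_szekeresField_le hf2 hK h0 ha y
    · have : Continuous fun x : ℝ => Real.exp K * |x - toFun f x| := by
        have := continuous_toFun f
        fun_prop
      simpa [toFun_at_one] using (this.tendsto 1).mono_left nhdsWithin_le_nhds
  · have h1 := (hf.contDiffOn_szekeresField hf2 hK h0 ha).continuousOn x ⟨hx.1, h⟩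
    refine h1.mono_of_mem_nhdsWithin ?_
    rw [← Ici_inter_Iio, inter_comm]
    exact inter_mem (mem_nhdsWithin_of_mem_nhds (Iio_mem_nhds h))
      (mem_of_superset self_mem_nhdsWithin Icc_subset_Ici_self)

/-- Existence of Szekeres' vector field at a parabolic attracting fixed point. -/
theorem exists_isSzekeres (hf : MovesLeft f) (hf2 : IsDiffeo 2 f) (h0 : logD f 0 = 0) :
    ∃ X φ, IsSzekeres f (Ico 0 1) X φ := by
  classical
  obtain ⟨K, hK⟩ := hf2.exists_lipschitzOnWith_logD
  obtain ⟨a, ha⟩ : (Ioo (0 : ℝ) 1).Nonempty := ⟨1 / 2, by norm_num⟩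
  set T := timeCoord f a with hT
  set A := timeStep f a
  have hmono : StrictMonoOn T (Ioo 0 1) := hf.strictMonoOn_timeCoord hf2 hK ha
  choose δ hδ hTδ using hf.surjOn_timeCoord hf2 hK h0 ha
  have hδT : ∀ x ∈ Ioo (0 : ℝ) 1, δ (T x) = x := fun x hx => hmono.injOn (hδ _) hx (hTδ _)
  have hδmono : Monotone δ := fun s t hst => by
    rw [← hmono.le_iff_le (hδ s) (hδ t)]
    simp only [hT, hTδ]
    exact hst
  -- A monotone function whose range fills (0,1) has no jumps.
  have hδc : ∀ s, ContinuousAt δ s := fun s =>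
    continuousAt_of_monotoneOn_of_image_mem_nhds (hδmono.monotoneOn univ) univ_mem
      (mem_of_superset (Ioo_mem_nhds (hδ s).1 (hδ s).2) fun x hx => ⟨T x, mem_univ _, hδT x hx⟩)
  have hδd : ∀ s, HasDerivAt δ (Real.exp (logDLimit f a (δ s)))⁻¹ s := fun s =>
    HasDerivAt.of_local_left_inverse (hδc s) (hf.hasDerivAt_timeCoord hf2 hK ha (hδ s))
      (Real.exp_pos _).ne' (Eventually.of_forall hTδ)
  -- In the coordinate T the flow is translation by −A·t, with T inverted by δ; the endpoint 0 stays
  -- fixed.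
  refine ⟨szekeresField f a, fun t x => if x ∈ Ioo (0 : ℝ) 1 then δ (T x - A * t) else x,
    hf.contDiffOn_szekeresField hf2 hK h0 ha, hf.continuousOn_szekeresField hf2 hK h0 ha,
    fun t x hx => ?_, fun x hx => ?_, fun x hx t => ?_, fun x hx => ?_⟩
  · split_ifs with h
    · exact Ioo_subset_Ico_self (hδ _)
    · exact hx
  · split_ifs with h
    · rw [mul_zero, sub_zero, hδT x h]
    · rfl
  · by_cases h : x ∈ Ioo (0 : ℝ) 1
    · simp only [if_pos h]
      have h1 : HasDerivAt (fun t => T x - A * t) (-A) t := by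
        simpa using ((hasDerivAt_id t).const_mul A).const_sub (T x)
      refine ((hδd (T x - A * t)).comp t h1).congr_deriv ?_
      rw [szekeresField, if_pos (hδ _), Real.exp_neg]
      ring
    · simp only [if_neg h]
      have : szekeresField f a x = 0 := by rw [szekeresField, if_neg h]
      rw [this]
      exact hasDerivAt_const _ _
  · split_ifs with h
    · rw [mul_one, ← hf.timeCoord_apply hf2 hK h0 ha h]
      exact hδT _ (toFun_mem_Ioo f h)
    · have : x = 0 := by
        by_contra hne
        exact h ⟨hx.1.lt_of_ne (Ne.symm hne), hx.2⟩
      rw [this, toFun_zero]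

end MovesLeft

theorem exists_isSzekeres_Ico {f : Homeo} (hf2 : IsDiffeo 2 f) (hf : NoInteriorFixedPoint f)
    (h0 : logD f 0 = 0) : ∃ X φ, IsSzekeres f (Ico 0 1) X φ := by
  rcases hf.movesRight_or with h | h
  · obtain ⟨X, φ, hX⟩ := h.inv_movesLeft.exists_isSzekeres hf2.inv
      (logD_inv_eq_zero (hf2.of_le one_le_two) (by simp) toFun_zero h0)
    have := hX.inv isUnitInterval_Ico
    rw [inv_inv] at this
    exact ⟨_, _, this⟩
  · exact h.movesLeft.exists_isSzekeres hf2 h0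

/-! ### Transfer to the endpoint 1 by reflection. -/

/-- The conjugate of `f` by the reflection `x ↦ 1 - x`. -/
noncomputable def reflect (f : Homeo) : Homeo where
  toFun x := unitInterval.symm (f (unitInterval.symm x))
  invFun x := unitInterval.symm (f.symm (unitInterval.symm x))
  left_inv x := by simp
  right_inv x := by simp
  map_rel_iff' {x y} := by
    have hs : ∀ u v : unitInterval,
        unitInterval.symm u ≤ unitInterval.symm v ↔ v ≤ u := fun u v => by
      rw [← Subtype.coe_le_coe, ← Subtype.coe_le_coe, unitInterval.coe_symm_eq,
        unitInterval.coe_symm_eq, sub_le_sub_iff_left]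
    simp only [Equiv.coe_fn_mk, hs, f.le_iff_le]

theorem one_sub_mem_Icc {x : ℝ} (hx : x ∈ Icc (0 : ℝ) 1) : 1 - x ∈ Icc (0 : ℝ) 1 :=
  ⟨by linarith [hx.2], by linarith [hx.1]⟩

theorem toFun_reflect (f : Homeo) {x : ℝ} (hx : x ∈ Icc (0 : ℝ) 1) :
    toFun (reflect f) x = 1 - toFun f (1 - x) := by
  rw [toFun_of_mem _ hx, toFun_of_mem _ (one_sub_mem_Icc hx)]
  rfl

theorem IsDiffeo.reflect {f : Homeo} {r : ℕ} (hf : IsDiffeo r f) : IsDiffeo r (reflect f) := by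
  have key : ∀ {g : Homeo}, ContDiffOn ℝ r (toFun g) (Icc 0 1) →
      ContDiffOn ℝ r (toFun (IntervalDiffeo.reflect g)) (Icc 0 1) := fun {g} hg =>
    (contDiffOn_const.sub (hg.comp (contDiffOn_const.sub contDiffOn_id)
      fun x hx => one_sub_mem_Icc hx)).congr fun x hx => toFun_reflect g hx
  exact ⟨key hf.1, key hf.2⟩

theorem D_reflect_zero {f : Homeo} (hf : IsDiffeo 1 f) : D (reflect f) 0 = D f 1 := by
  have h0 : (0 : ℝ) ∈ Icc (0 : ℝ) 1 := by simp
  have h1 : HasDerivWithinAt (toFun f) (D f 1) (Icc 0 1) ((fun x : ℝ => 1 - x) 0) := by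
    simpa using hf.hasDerivWithinAt (x := 1) (by simp)
  have h2 := (h1.comp (h := fun x : ℝ => 1 - x) 0
    (((hasDerivWithinAt_id (0 : ℝ) (Icc 0 1))).const_sub 1)
    fun x hx => one_sub_mem_Icc hx).const_sub 1
  have h3 := h2.congr (f₁ := toFun (reflect f)) (fun x hx => toFun_reflect f hx)
    (toFun_reflect f h0)
  rw [D, h3.derivWithin (uniqueDiffOn_unit 0 h0)]
  ring

theorem NoInteriorFixedPoint.reflect {f : Homeo} (hf : NoInteriorFixedPoint f) :
    NoInteriorFixedPoint (reflect f) := fun x h0 h1 h => by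
  have e := toFun_reflect f x.2
  rw [toFun_coe, h] at e
  exact hf.toFun_ne (x := 1 - x) ⟨by linarith, by linarith⟩ (by linarith)

theorem IsSzekeres.of_reflect {f : Homeo} {X : ℝ → ℝ} {φ : ℝ → ℝ → ℝ}
    (h : IsSzekeres (reflect f) (Ico 0 1) X φ) :
    IsSzekeres f (Ioc 0 1) (fun x => -X (1 - x)) (fun t x => 1 - φ t (1 - x)) := by
  have hm : ∀ x ∈ Ioc (0 : ℝ) 1, 1 - x ∈ Ico (0 : ℝ) 1 := fun x hx =>
    ⟨by linarith [hx.2], by linarith [hx.1]⟩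
  refine ⟨(h.contDiffOn.comp (contDiffOn_const.sub contDiffOn_id) hm).neg,
    (h.continuousOn.comp (continuousOn_const.sub continuousOn_id) fun x hx =>
      one_sub_mem_Icc hx).neg, fun t x hx => ?_, fun x hx => ?_, fun x hx t => ?_, fun x hx => ?_⟩
  · have := h.mapsTo t (hm x hx)
    exact ⟨by linarith [this.2], by linarith [this.1]⟩
  · rw [h.map_zero _ (hm x hx)]; ring
  · rw [sub_sub_cancel]
    exact (h.hasDerivAt _ (hm x hx) t).const_sub 1
  · rw [h.map_one _ (hm x hx), toFun_reflect f (Ico_subset_Icc_self (hm x hx)), sub_sub_cancel,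
      sub_sub_cancel]

theorem exists_isSzekeres_Ioc {f : Homeo} (hf2 : IsDiffeo 2 f) (hf : NoInteriorFixedPoint f)
    (h1 : logD f 1 = 0) : ∃ X φ, IsSzekeres f (Ioc 0 1) X φ := by
  obtain ⟨X, φ, h⟩ := exists_isSzekeres_Ico hf2.reflect hf.reflect
    (by rw [logD, D_reflect_zero (hf2.of_le one_le_two)]; exact h1)
  exact ⟨_, _, h.of_reflect⟩

/-! ### Mather maps and their classes on the circle. -/

theorem exists_isMatherMap_of_movesRight {f : Homeo} (hf2 : IsDiffeo 2 f) (hf : MovesRight f)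
    (h0 : logD f 0 = 0) (h1 : logD f 1 = 0) {a b : ℝ} (ha : a ∈ Ioo (0 : ℝ) 1)
    (hb : b ∈ Ioo (0 : ℝ) 1) : ∃ M, IsMatherMap f a b M := by
  obtain ⟨X, φ, hX⟩ := exists_isSzekeres_Ico hf2 hf.noInteriorFixedPoint h0
  obtain ⟨Y, ψ, hY⟩ := exists_isSzekeres_Ioc hf2 hf.noInteriorFixedPoint h1
  choose M hM using fun t => hY.exists_flow_eq isUnitInterval_Ioc hf hb
    (hX.flow_mem_Ioo isUnitInterval_Ico ha t)
  exact ⟨M, X, Y, φ, ψ, hX, hY, hM⟩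

theorem exists_isMatherMap {f : Homeo} (hf2 : IsDiffeo 2 f) (hf : NoInteriorFixedPoint f)
    (h0 : logD f 0 = 0) (h1 : logD f 1 = 0) {a b : ℝ} (ha : a ∈ Ioo (0 : ℝ) 1)
    (hb : b ∈ Ioo (0 : ℝ) 1) : ∃ M, IsMatherMap f a b M := by
  have hf1 : IsDiffeo 1 f := hf2.of_le one_le_two
  rcases hf.movesRight_or with h | h
  · exact exists_isMatherMap_of_movesRight hf2 h h0 h1 ha hb
  · obtain ⟨M, hM⟩ := exists_isMatherMap_of_movesRight hf2.inv h
      (logD_inv_eq_zero hf1 (by simp) toFun_zero h0)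
      (logD_inv_eq_zero hf1 (by simp) toFun_at_one h1) ha hb
    have := hM.inv
    rw [inv_inv] at this
    exact ⟨_, this⟩

/-- Increments of M(t) − t are integers. Over a time less than 1, monotonicity and M(t+1) = M(t) + 1
keep them in (−1,1), so they vanish; continuity of M is not needed. -/
theorem exists_eq_add_const_of_coe_sub_eq_of_movesRight {f : Homeo} (hf : MovesRight f) {a b : ℝ}
    (ha : a ∈ Ioo (0 : ℝ) 1) (hb : b ∈ Ioo (0 : ℝ) 1) {M : ℝ → ℝ} (hM : IsMatherMap f a b M)
    {κ : UnitAddCircle} (hκ : ∀ t, ((M t - t : ℝ) : UnitAddCircle) = κ) :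
    ∃ d, ∀ t, M t = t + d := by
  have hN : ∀ t s, 0 ≤ s → s ≤ 1 → M (t + s) - (t + s) = M t - t := by
    intro t s hs0 hs1
    have h1 := hM.add_one hf ha hb t
    rcases hs0.eq_or_lt with rfl | hs0
    · rw [add_zero]
    rcases hs1.eq_or_lt with rfl | hs1
    · rw [h1]; ring
    have hmono := hM.strictMono hf ha hb
    have h2 : M t < M (t + s) := hmono (by linarith)
    have h3 : M (t + s) < M (t + 1) := hmono (by linarith)
    have h4 : (((M (t + s) - (t + s)) - (M t - t) : ℝ) : UnitAddCircle) = 0 := by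
      rw [AddCircle.coe_sub, hκ, hκ, sub_self]
    obtain ⟨n, hn⟩ := (AddCircle.coe_eq_zero_iff _).1 h4
    rw [zsmul_eq_mul, mul_one] at hn
    have h5 : (-1 : ℝ) < n := by linarith
    have h6 : (n : ℝ) < 1 := by linarith
    have h7 : n = 0 := by
      have : -1 < n := by exact_mod_cast h5
      have : n < 1 := by exact_mod_cast h6
      omega
    rw [h7, Int.cast_zero] at hn
    linarith
  refine ⟨M 0, fun t => ?_⟩
  have := eq_const_of_add_eq (R := fun t => M t - t) hN t
  rw [sub_zero] at this
  linarith

theorem IsMatherMap.exists_eq_add_const_of_coe_sub_eq {f : Homeo} (hf : NoInteriorFixedPoint f)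
    {a b : ℝ} (ha : a ∈ Ioo (0 : ℝ) 1) (hb : b ∈ Ioo (0 : ℝ) 1) {M : ℝ → ℝ}
    (hM : IsMatherMap f a b M) {κ : UnitAddCircle}
    (hκ : ∀ t, ((M t - t : ℝ) : UnitAddCircle) = κ) : ∃ d, ∀ t, M t = t + d := by
  rcases hf.movesRight_or with h | h
  · exact exists_eq_add_const_of_coe_sub_eq_of_movesRight h ha hb hM hκ
  · obtain ⟨d, hd⟩ := exists_eq_add_const_of_coe_sub_eq_of_movesRight h ha hb hM.inv (κ := -κ)
      fun t => by
        rw [← hκ (-t), ← AddCircle.coe_neg]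
        congr 1; ring
    refine ⟨-d, fun t => ?_⟩
    have := hd (-t)
    rw [neg_neg] at this
    linarith

/-- The Mather invariant is trivial as soon as Mather maps exist and are translations. -/
theorem matherTrivial_of_translation {f : Homeo}
    (hex : ∃ M, IsMatherMap f (1 / 2) (1 / 2) M)
    (htrans : ∀ a ∈ Ioo (0 : ℝ) 1, ∀ b ∈ Ioo (0 : ℝ) 1, ∀ M, IsMatherMap f a b M →
      ∃ d, ∀ t, M t = t + d) : MatherTrivial f := by
  ext g
  constructor
  · rintro ⟨a, ha, b, hb, M, hM, m, hm, α, β, hg⟩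
    obtain ⟨d, hd⟩ := htrans a ha b hb M hM
    have hm' : ∀ x, m x = x + (d : UnitAddCircle) := fun x => by
      induction x using QuotientAddGroup.induction_on with
      | H t => rw [hm, hd, AddCircle.coe_add]
    refine ⟨α + d + β, ?_⟩
    ext x
    simp only [hg, hm']
    abel
  · rintro ⟨γ, rfl⟩
    obtain ⟨M, hM⟩ := hex
    have hhalf : (1 / 2 : ℝ) ∈ Ioo (0 : ℝ) 1 := by norm_num
    obtain ⟨d, hd⟩ := htrans _ hhalf _ hhalf M hM
    refine ⟨1 / 2, hhalf, 1 / 2, hhalf, M, hM, fun x => x + (d : UnitAddCircle), fun t => by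
      rw [hd, AddCircle.coe_add], 0, γ - d, fun x => ?_⟩
    simp only
    abel

theorem MatherTrivial.exists_translation {f : Homeo} (hf : NoInteriorFixedPoint f)
    (h : MatherTrivial f) : ∃ a ∈ Ioo (0 : ℝ) 1, ∃ b ∈ Ioo (0 : ℝ) 1, ∃ M d,
      IsMatherMap f a b M ∧ ∀ t, M t = t + d := by
  -- The identity of the circle is a rotation, hence a representative of the invariant; solving for
  -- m shows that m is a rotation.
  have hmem : (fun x : UnitAddCircle => x + 0) ∈ matherInvariant f := by
    rw [h]; exact ⟨0, rfl⟩
  obtain ⟨a, ha, b, hb, M, hM, m, hm, α, β, hg⟩ := hmem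
  obtain ⟨d, hd⟩ := hM.exists_eq_add_const_of_coe_sub_eq hf ha hb (κ := -α - β) fun t => by
    have := hg ((t : UnitAddCircle) - α)
    rw [sub_add_cancel, hm] at this
    simp only [add_zero] at this
    rw [AddCircle.coe_sub, eq_sub_of_add_eq this.symm]
    abel
  exact ⟨a, ha, b, hb, M, d, hM, hd⟩

end IntervalDiffeo

theorem corollaryB (f : IntervalDiffeo.Homeo) (hf : IntervalDiffeo.IsDiffeo 2 f)
    (hfix : IntervalDiffeo.NoInteriorFixedPoint f) :
    (1 : IntervalDiffeo.Homeo) ∈ IntervalDiffeo.closureBV (IntervalDiffeo.conjClassBV f) ↔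
      (IntervalDiffeo.D f 0 = 1 ∧ IntervalDiffeo.D f 1 = 1) ∧
        IntervalDiffeo.MatherTrivial f := by
  have hf1 : IntervalDiffeo.IsDiffeo 1 f := hf.of_le one_le_two
  constructor
  · intro h
    have h0 := IntervalDiffeo.D_eq_one_of_mem_closureBV hf1 h (by simp) IntervalDiffeo.toFun_zero
    have h1 := IntervalDiffeo.D_eq_one_of_mem_closureBV hf1 h (by simp) IntervalDiffeo.toFun_at_one
    have h0' := (IntervalDiffeo.logD_eq_zero_iff hf1 (by simp)).2 h0
    have h1' := (IntervalDiffeo.logD_eq_zero_iff hf1 (by simp)).2 h1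
    refine ⟨⟨h0, h1⟩, IntervalDiffeo.matherTrivial_of_translation
      (IntervalDiffeo.exists_isMatherMap hf hfix h0' h1' (by norm_num) (by norm_num))
      fun a ha b hb M hM => hM.exists_eq_add_const hf1 hfix h0' h1'
        (IntervalDiffeo.HasSmallConjugates.of_mem_closureBV h) ha hb⟩
  · rintro ⟨⟨h0, h1⟩, hM⟩
    obtain ⟨a, ha, b, hb, M, d, hM, hd⟩ := hM.exists_translation hfix
    exact (hM.hasSmallConjugates hf hfix ((IntervalDiffeo.logD_eq_zero_iff hf1 (by simp)).2 h0)
      ((IntervalDiffeo.logD_eq_zero_iff hf1 (by simp)).2 h1) ha hb hd).mem_closureBV hf1 h0
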